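/- Let $W$ be a standard Brownian motion and $N$ an independent Poisson process with intensity $r\ge 0$, and let $x_R\in\mathbb R$. For $x\in\mathbb R$ let $X^x$ be the càdlàg solution of $dX_t=dW_t+(x_R-X_{t-})\,dN_t$, $X_0=x$, i.e. $X_t=x+W_t+\sum_{n=1}^{N_t}(x_R-X_{\tau_n-})$, where $\tau_n=\inf\{t: N_t\ge n\}$ (Brownian motion reset to $x_R$ at rate $r$). Write $\mathcal A g(x)=\lim_{t\downarrow 0}\frac1t\big(\mathbb E[g(X^x_t)]-g(x)\big)$ for the infinitesimal generator. Then: 1. For every $g\in C^2(\mathbb R)$ with $|g(x)|\le Ce^{c|x|}$ for some constants $C,c$, all $g(X^x_t)$ are integrable, and for every $x$ the limit exists and equals $\mathcal A g(x)=\tfrac12 g''(x)+r\,(g(x_R)-g(x))$. If $g$ and $g''$ are bounded and $g''$ is uniformly continuous, the limit is uniform in $x$. 2. For $f\in L^1(\mathbb R)$ let $\mathcal A^*f$ be the distribution defined by $\langle \mathcal A^* f,\varphi\rangle=\int_{\mathbb R} f(z)\,\mathcal A\varphi(z)\,dz$ for all $\varphi\in C_c^\infty(\mathbb R)$. Then $\mathcal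 A^* f=\tfrac12 f''+r\big(\delta_{x_R}\int_{\mathbb R} f(z)\,dz-f\big)$, with $f''$ the distributional derivative. If $f\in C^2$ and $f,f',f''\in L^1$, then $f''$ is here the classical second derivative, and for every $g\in C^2$ with $g,g',g''$ bounded, $f\,\mathcal A g$ is integrable and $\int f\,\mathcal A g\,dz=\int(\tfrac12 f''-rf)\,g\,dz+r\,g(x_R)\int f\,dz$. 3. For every $x_0\in\mathbb R$ and $t>0$, $X^{x_0}_t$ has a probability density $p(\cdot,t)$ with $\int p(z,t)\,dz=1$, and, in the sense of distributions in $x$ (for every $\varphi\in C_c^\infty(\mathbb R)$ the function $t\mapsto\int p(x,t)\varphi(x)\,dx$ is differentiable on $(0,\infty)$, with derivative $\langle\mathcal A^*p(\cdot,t),\varphi\rangle$), $$\partial_t p=\mathcal A^*p=\tfrac12\partial_{xx}p+r\Big(\delta_{x_R}\int_{\mathbb R} p(z,t)\,dz-p\Big)=\tfrac12\partial_{xx}p+r\,\delta_{x_R}-r\,p,$$ the standard Fokker–Planck equation with resetting; moreover $\int p(x,t)\varphi(x)\,dx\to\varphi(x_0)$ as $t\downarrow0$, i.e. $p(\cdot,0)=\delta_{x_0}$.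 -/

import Mathlib

open MeasureTheory ProbabilityTheory Filter Topology Set
open scoped NNReal ENNReal Distributions LineDeriv

namespace Resetting

/-- A (homogeneous) Poisson process with intensity `r`: it starts at `0`, has independent increments,
its increments over `[s, t]` are Poisson distributed with mean `r (t - s)`, and almost surely its
paths are non-decreasing, right-continuous and have jumps of size one only. -/
structure IsPoissonProcess {Ω : Type*} [MeasurableSpace Ω] (N : ℝ≥0 → Ω → ℕ) (r : ℝ≥0)
    (P : Measure Ω) : Prop where
  measurable : ∀ t, Measurable (N t)
  zero : ∀ᵐ ω ∂P, N 0 ω = 0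
  indepIncrements : HasIndepIncrements N P
  hasLaw_increments : ∀ s t, s ≤ t →
    HasLaw (fun ω ↦ N t ω - N s ω) (poissonMeasure (r * (t - s))) P
  mono : ∀ᵐ ω ∂P, Monotone (fun t ↦ N t ω)
  rightCont : ∀ᵐ ω ∂P, ∀ t, ContinuousWithinAt (fun s ↦ N s ω) (Ici t) t
  unitJumps : ∀ᵐ ω ∂P, ∀ t, N t ω ≤ Function.leftLim (fun s ↦ N s ω) t + 1

/-- The `n`-th jump time of a counting path `ν`: the first time at which `ν` is at least `n`. -/
noncomputable def jumpTime (ν : ℝ≥0 → ℕ) (n : ℕ) : ℝ≥0 := sInf {s | n ≤ ν s}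

/-- `X` is a càdlàg solution of `dX_t = dW_t + (x_R - X_{t-}) dN_t`, `X_0 = x₀`, that is,
`X_t = x₀ + W_t + ∑_{n = 1}^{N_t} (x_R - X_{τ_n -})`, where `τ_n` is the `n`-th jump time of `N`. -/
def IsResettingSolution {Ω : Type*} [MeasurableSpace Ω] (P : Measure Ω)
    (W : ℝ≥0 → Ω → ℝ) (N : ℝ≥0 → Ω → ℕ) (xR x₀ : ℝ) (X : ℝ≥0 → Ω → ℝ) : Prop :=
  ∀ᵐ ω ∂P,
    (∀ t, ContinuousWithinAt (fun s ↦ X s ω) (Ici t) t) ∧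
    (∀ t, ∃ l, Tendsto (fun s ↦ X s ω) (𝓝[<] t) (𝓝 l)) ∧
    ∀ t, X t ω = x₀ + W t ω + ∑ n ∈ Finset.Icc 1 (N t ω),
      (xR - Function.leftLim (fun s ↦ X s ω) (jumpTime (fun s ↦ N s ω) n))

section Generator

/-! In this section `X x` is the process started at the point `x`. -/

variable {Ω : Type*} [MeasurableSpace Ω]

/-- The difference quotient `(𝔼[g(X_t^x)] - g(x)) / t`. -/
noncomputable def generatorQuotient (X : ℝ → ℝ≥0 → Ω → ℝ) (P : Measure Ω) (g : ℝ → ℝ)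
    (t : ℝ≥0) (x : ℝ) : ℝ :=
  (∫ ω, g (X x t ω) ∂P - g x) / t

/-- `HasGenerator X P g h` says that `g` is in the domain of the infinitesimal generator `𝒜` of `X`
and `𝒜 g = h`: the expectations `𝔼[g(X_t^x)]` exist, and
`(𝔼[g(X_t^x)] - g(x)) / t → h(x)` as `t ↓ 0`, for every `x`. -/
def HasGenerator (X : ℝ → ℝ≥0 → Ω → ℝ) (P : Measure Ω) (g h : ℝ → ℝ) : Prop :=
  (∀ x t, Integrable (fun ω ↦ g (X x t ω)) P) ∧
  ∀ x, Tendsto (fun t : ℝ≥0 ↦ generatorQuotient X P g t x) (𝓝[>] 0) (𝓝 (h x))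

/-- `HasAdjointGenerator X P f T` says that the distribution `T` on `ℝ` is `𝒜* f`, where `𝒜` is the
infinitesimal generator of `X`: every test function `φ` is in the domain of `𝒜`, and
`⟨T, φ⟩ = ∫ f(z) 𝒜φ(z) dz`. -/
def HasAdjointGenerator (X : ℝ → ℝ≥0 → Ω → ℝ) (P : Measure Ω) (f : ℝ → ℝ)
    (T : 𝓓'((⊤ : TopologicalSpace.Opens ℝ), ℝ)) : Prop :=
  ∀ φ : 𝓓((⊤ : TopologicalSpace.Opens ℝ), ℝ), ∃ h : ℝ → ℝ,
    HasGenerator X P φ h ∧ Integrable (fun z ↦ f z * h z) ∧ T φ = ∫ z, f z * h z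

/-- The density `p(·, t)` of the law of `X_t`, for a real time `t` (used for `t > 0`). -/
noncomputable def density (X : ℝ≥0 → Ω → ℝ) (P : Measure Ω) (t : ℝ) (x : ℝ) : ℝ :=
  (pdf (X t.toNNReal) P volume x).toReal

end Generator

/-- The distribution `φ ↦ ∫ φ(x) f(x) dx` given by a locally integrable function `f`. -/
noncomputable def ofFun (f : ℝ → ℝ) : 𝓓'((⊤ : TopologicalSpace.Opens ℝ), ℝ) where
  toFun φ := TestFunction.integralAgainstBilinCLM (𝕜 := ℝ) (ContinuousLinearMap.mul ℝ ℝ) volume f φ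
  map_add' φ ψ := map_add _ φ ψ
  map_smul' c φ := map_smul _ c φ
  cont := (TestFunction.integralAgainstBilinCLM (𝕜 := ℝ)
    (ContinuousLinearMap.mul ℝ ℝ) volume f).cont

theorem ofFun_apply {f : ℝ → ℝ} (hf : LocallyIntegrable f)
    (φ : 𝓓((⊤ : TopologicalSpace.Opens ℝ), ℝ)) : ofFun f φ = ∫ x, φ x * f x :=
  TestFunction.integralAgainstBilinCLM_eq_integral (𝕜 := ℝ) (hf.locallyIntegrableOn _)

/-- `∂_t u = T` at time `t`, for a curve `u` of distributions, in the weak-* sense. -/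
def HasTimeDerivAt (u : ℝ → 𝓓'((⊤ : TopologicalSpace.Opens ℝ), ℝ))
    (T : 𝓓'((⊤ : TopologicalSpace.Opens ℝ), ℝ)) (t : ℝ) : Prop :=
  ∀ φ : 𝓓((⊤ : TopologicalSpace.Opens ℝ), ℝ), HasDerivAt (fun s ↦ u s φ) (T φ) t

/-- `½ g''(x) + r (g(x_R) - g(x))`. -/
noncomputable def resettingOperator (r : ℝ≥0) (xR : ℝ) (g : ℝ → ℝ) (x : ℝ) : ℝ :=
  (1 / 2) * iteratedDeriv 2 g x + r * (g xR - g x)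

/-- `½ f'' + r (δ_{x_R} ∫ f - f)`, a distribution; `f''` is the distributional derivative. -/
noncomputable def resettingAdjoint (r : ℝ≥0) (xR : ℝ) (f : ℝ → ℝ) :
    𝓓'((⊤ : TopologicalSpace.Opens ℝ), ℝ) :=
  (1 / 2 : ℝ) • ∂_{(1 : ℝ)} (∂_{(1 : ℝ)} (ofFun f)) +
    (r : ℝ) • ((∫ z, f z) • Distribution.delta xR - ofFun f)

end Resetting

/-!
A solution is a Brownian path that is restarted at the last jump: as `W` is continuous and the jumps
of `N` have size one, the equation forces `X = xR` at every jump time, hence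
`X_t = xR + W_t - W_L` with `L` the last jump time before `t`, and `X_t = x₀ + W_t` if there was no
jump (`eq_restarted`). Since `{L ≤ s}` is the event of no jump in `(s, t]`, the age `t - L` has the
law of `min(τ, t)` with `τ` exponential of rate `r` (`IsPoissonProcess.map_age`). The path of `W` is
independent of `L`, so `L` can be frozen in the Brownian increment, which gives the law of `X_t` as
a mixture of normal laws (`IsResettingSolution.map_eq`) and the renewal formula
`𝔼[g(X_t)] = e^{-rt} (H_t g)(x₀) + ∫₀ᵗ r e^{-rs} (H_s g)(xR) ds`
(`IsResettingSolution.integral_comp`), where `H_s g(x) = 𝔼[g(x + √s Z)]` is the heat semigroup.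

Everything else is read off this formula.
* The generator: `(H_t g - g) / t → ½ g''` by a second-order Taylor expansion whose remainder is at
  most `ε y² + K |y|³ e^{c|y|}`, so that only Gaussian moments are needed and no bound on `g'` or
  `g''` at infinity. The same estimate at one point, or uniformly in the point (`UniformTaylor`),
  gives both the pointwise and the uniform statement.
* The adjoint: limits are unique, so `𝒜φ` is known for every test function `φ`; the rest is
  integration by parts.
* The Fokker-Planck equation: Stein's lemma gives `∂ₛ H_s φ = ½ H_s φ''` for `s > 0`
  (`hasDerivAt_heat`), and differentiating the renewal formula and integrating
  `∂ₛ (e^{-rs} (H_s φ(xR) - φ(xR)))` gives `d/dt 𝔼[φ(X_t)] = 𝔼[𝒜φ(X_t)]`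
  (`hasDerivAt_expectation`).
-/

namespace Resetting

/-! ### Counting paths and the pathwise solution -/

section Paths

variable {ν : ℝ≥0 → ℕ}

lemma jumpTime_le {n : ℕ} {t : ℝ≥0} (h : n ≤ ν t) : jumpTime ν n ≤ t :=
  csInf_le (OrderBot.bddBelow _) h

lemma lt_of_lt_jumpTime {n : ℕ} {s : ℝ≥0} (h : s < jumpTime ν n) : ν s < n := by
  by_contra! h'
  exact absurd (jumpTime_le h') (not_le.2 h)

/-- By right-continuity the infimum defining a jump time is attained. -/
lemma le_apply_jumpTime (hmono : Monotone ν) (hrc : ∀ t, ContinuousWithinAt ν (Ici t) t)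
    {n : ℕ} {t : ℝ≥0} (h : n ≤ ν t) : n ≤ ν (jumpTime ν n) := by
  have h1 : ∀ᶠ s in 𝓝[>] jumpTime ν n, ν s = ν (jumpTime ν n) := by
    have := ((hrc (jumpTime ν n)).mono Ioi_subset_Ici_self).tendsto
    rw [nhds_discrete] at this
    exact tendsto_pure.1 this
  obtain ⟨s, hs, hs'⟩ := (h1.and self_mem_nhdsWithin).exists
  obtain ⟨u, hu, hus⟩ := exists_lt_of_csInf_lt (s := {s | n ≤ ν s}) ⟨t, h⟩ hs'
  rw [← hs]
  exact le_trans hu (hmono hus.le)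

lemma jumpTime_pos (h0 : ν 0 = 0) (hmono : Monotone ν)
    (hrc : ∀ t, ContinuousWithinAt ν (Ici t) t) {n : ℕ} {t : ℝ≥0} (hn : n ≠ 0) (h : n ≤ ν t) :
    0 < jumpTime ν n := by
  rw [pos_iff_ne_zero]
  intro h'
  have := le_apply_jumpTime hmono hrc h
  rw [h', h0] at this
  omega

/-- Immediately before its `n`-th jump a counting path with unit jumps equals `n - 1`. -/
lemma eventually_eq_before_jumpTime (hmono : Monotone ν)
    (hrc : ∀ t, ContinuousWithinAt ν (Ici t) t)
    (hunit : ∀ t, ν t ≤ Function.leftLim ν t + 1) {n : ℕ} {t : ℝ≥0} (h : n + 1 ≤ ν t) :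
    ∀ᶠ s in 𝓝[<] jumpTime ν (n + 1), ν s = n := by
  have h1 : ∀ᶠ s in 𝓝[<] jumpTime ν (n + 1), ν s = Function.leftLim ν (jumpTime ν (n + 1)) := by
    have := hmono.tendsto_leftLim (jumpTime ν (n + 1))
    rw [nhds_discrete] at this
    exact tendsto_pure.1 this
  filter_upwards [h1, self_mem_nhdsWithin] with s hs hs'
  have h2 := le_apply_jumpTime hmono hrc h
  have h3 := hunit (jumpTime ν (n + 1))
  have h4 := lt_of_lt_jumpTime hs'
  omega

lemma apply_jumpTime (h0 : ν 0 = 0) (hmono : Monotone ν)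
    (hrc : ∀ t, ContinuousWithinAt ν (Ici t) t)
    (hunit : ∀ t, ν t ≤ Function.leftLim ν t + 1) {n : ℕ} {t : ℝ≥0} (h : n ≤ ν t) :
    ν (jumpTime ν n) = n := by
  refine le_antisymm ?_ (le_apply_jumpTime hmono hrc h)
  rcases n with _ | n
  · have : jumpTime ν 0 = 0 := le_antisymm (jumpTime_le (Nat.zero_le _)) (zero_le)
    rw [this, h0]
  · have hpos := jumpTime_pos h0 hmono hrc (Nat.succ_ne_zero n) h
    have : (𝓝[<] jumpTime ν (n + 1)).NeBot := nhdsLT_neBot_of_exists_lt ⟨0, hpos⟩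
    have h1 : Function.leftLim ν (jumpTime ν (n + 1)) = n := by
      refine leftLim_eq_of_tendsto (Tendsto.congr' ?_ tendsto_const_nhds)
      filter_upwards [eventually_eq_before_jumpTime hmono hrc hunit h] with s hs using hs.symm
    have := hunit (jumpTime ν (n + 1))
    omega

lemma jumpTime_le_iff (hmono : Monotone ν) (hrc : ∀ t, ContinuousWithinAt ν (Ici t) t)
    {t s : ℝ≥0} : jumpTime ν (ν t) ≤ s ↔ ν t ≤ ν s :=
  ⟨fun h ↦ (le_apply_jumpTime hmono hrc le_rfl).trans (hmono h), jumpTime_le⟩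

lemma jumpTime_eq_zero_iff (h0 : ν 0 = 0) (hmono : Monotone ν)
    (hrc : ∀ t, ContinuousWithinAt ν (Ici t) t) {t : ℝ≥0} :
    jumpTime ν (ν t) = 0 ↔ ν t = 0 := by
  rw [← nonpos_iff_eq_zero, jumpTime_le_iff hmono hrc, h0, nonpos_iff_eq_zero]

/-- The solution is in the state `xR` at each jump time: the summand for the `n`-th jump replaces
the left limit there by `xR`, since the driving path `w` is continuous. -/
lemma eq_of_jumpTime {w x : ℝ≥0 → ℝ} {xR x₀ : ℝ} (h0 : ν 0 = 0) (hmono : Monotone ν)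
    (hrc : ∀ t, ContinuousWithinAt ν (Ici t) t)
    (hunit : ∀ t, ν t ≤ Function.leftLim ν t + 1) (hw : Continuous w)
    (hx : ∀ t, x t = x₀ + w t +
      ∑ n ∈ Finset.Icc 1 (ν t), (xR - Function.leftLim x (jumpTime ν n)))
    {n : ℕ} {t : ℝ≥0} (h : n + 1 ≤ ν t) : x (jumpTime ν (n + 1)) = xR := by
  set τ := jumpTime ν (n + 1) with hτ
  have hpos : 0 < τ := jumpTime_pos h0 hmono hrc (Nat.succ_ne_zero n) h
  have hne : (𝓝[<] τ).NeBot := nhdsLT_neBot_of_exists_lt ⟨0, hpos⟩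
  have hlim : Function.leftLim x τ =
      x₀ + w τ + ∑ k ∈ Finset.Icc 1 n, (xR - Function.leftLim x (jumpTime ν k)) := by
    refine leftLim_eq_of_tendsto (Tendsto.congr' ?_
      ((tendsto_const_nhds.add (hw.tendsto τ |>.mono_left nhdsWithin_le_nhds)).add
        tendsto_const_nhds))
    filter_upwards [eventually_eq_before_jumpTime hmono hrc hunit h] with s hs
    rw [hx s, hs]
  rw [hx τ, hτ, apply_jumpTime h0 hmono hrc hunit h, Finset.sum_Icc_succ_top (by omega), ← hτ, hlim]
  ring

/-- The explicit form of the solution: a Brownian path restarted at the last jump time. Before the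
first jump the "last jump time" is `jumpTime ν 0 = 0`. -/
lemma eq_restarted {w x : ℝ≥0 → ℝ} {xR x₀ : ℝ} (h0 : ν 0 = 0) (hmono : Monotone ν)
    (hrc : ∀ t, ContinuousWithinAt ν (Ici t) t)
    (hunit : ∀ t, ν t ≤ Function.leftLim ν t + 1) (hw : Continuous w) (hw0 : w 0 = 0)
    (hx : ∀ t, x t = x₀ + w t +
      ∑ n ∈ Finset.Icc 1 (ν t), (xR - Function.leftLim x (jumpTime ν n))) (t : ℝ≥0) :
    x t = (if jumpTime ν (ν t) = 0 then x₀ else xR) + (w t - w (jumpTime ν (ν t))) := by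
  by_cases h : ν t = 0
  · have hz := (jumpTime_eq_zero_iff h0 hmono hrc).2 h
    rw [if_pos hz, hz, hw0, hx t, h]
    simp
  · rw [if_neg (mt (jumpTime_eq_zero_iff h0 hmono hrc).1 h)]
    obtain ⟨n, hn⟩ := Nat.exists_eq_succ_of_ne_zero h
    have h1 := eq_of_jumpTime h0 hmono hrc hunit hw hx (n := n) (t := t) hn.ge
    have h2 := hx (jumpTime ν (n + 1))
    rw [apply_jumpTime h0 hmono hrc hunit hn.ge, h1] at h2
    have h3 := hx t
    rw [hn] at h3 ⊢
    simp only [Nat.succ_eq_add_one] at h3 ⊢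
    linarith

end Paths

/-! ### The law of the time since the last reset -/

section AgeLaw

/-- The law of `min(τ, t)` for an exponential time `τ` of rate `r`: an atom of mass `e^{-rt}` at `t`
and the density `r e^{-rs}` on `(0, t]`. It also makes sense for `r = 0`, where `τ = ∞`. -/
noncomputable def ageLaw (r t : ℝ≥0) : Measure ℝ :=
  ENNReal.ofReal (Real.exp (-(r * t))) • Measure.dirac (t : ℝ) +
    (volume.restrict (Ioc 0 (t : ℝ))).withDensity fun s ↦ ENNReal.ofReal (r * Real.exp (-(r * s)))

/-- A measurable version of the last jump time before `t`, defined for all paths: the infimum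
over times `s` with `ν t ≤ ν s` is restricted to a countable dense set and to `t` itself. -/
noncomputable def lastJump (t : ℝ≥0) (ν : ℝ≥0 → ℕ) : ℝ≥0 :=
  ⨅ n : ℕ, if ν t ≤ ν (TopologicalSpace.denseSeq ℝ≥0 n) then TopologicalSpace.denseSeq ℝ≥0 n else t

lemma measurable_lastJump (t : ℝ≥0) : Measurable (lastJump t) := by
  refine Measurable.iInf fun n ↦ Measurable.ite ?_ measurable_const measurable_const
  exact measurableSet_le (measurable_pi_apply _) (measurable_pi_apply _)

lemma lastJump_eq {ν : ℝ≥0 → ℕ} (hmono : Monotone ν) (hrc : ∀ t, ContinuousWithinAt ν (Ici t) t)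
    (t : ℝ≥0) : lastJump t ν = jumpTime ν (ν t) := by
  refine le_antisymm (le_of_forall_gt_imp_ge_of_dense fun a ha ↦ ?_) (le_ciInf fun n ↦ ?_)
  · obtain ⟨n, hn⟩ := (TopologicalSpace.denseRange_denseSeq ℝ≥0).exists_mem_open isOpen_Ioo
      (nonempty_Ioo.2 ha)
    refine (ciInf_le (OrderBot.bddBelow _) n).trans ?_
    rw [if_pos ((jumpTime_le_iff hmono hrc).1 hn.1.le)]
    exact hn.2.le
  · split_ifs with h
    · exact jumpTime_le h
    · exact jumpTime_le le_rfl

lemma integral_exp_density (r : ℝ) (a b : ℝ) :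
    ∫ s in a..b, r * Real.exp (-(r * s)) = Real.exp (-(r * a)) - Real.exp (-(r * b)) := by
  have h : ∀ s ∈ uIcc a b,
      HasDerivAt (fun s ↦ -Real.exp (-(r * s))) (r * Real.exp (-(r * s))) s := by
    intro s _
    have := (((hasDerivAt_id' s).const_mul r).fun_neg.exp).fun_neg
    simpa [mul_comm] using this
  rw [intervalIntegral.integral_eq_sub_of_hasDerivAt h
    (Continuous.intervalIntegrable (by fun_prop) _ _)]
  ring

lemma lintegral_exp_density (r : ℝ≥0) {a b : ℝ} (hab : a ≤ b) :
    ∫⁻ s in Ioc a b, ENNReal.ofReal (r * Real.exp (-(r * s))) =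
      ENNReal.ofReal (Real.exp (-(r * a)) - Real.exp (-(r * b))) := by
  rw [← integral_exp_density, intervalIntegral.integral_of_le hab,
    ofReal_integral_eq_lintegral_ofReal]
  · exact (Continuous.integrableOn_Icc (by fun_prop)).mono_set Ioc_subset_Icc_self
  · exact Eventually.of_forall fun s ↦ by positivity

lemma ageLaw_Ici (r t : ℝ≥0) (s : ℝ) : ageLaw r t (Ici s) =
    if s ≤ t then ENNReal.ofReal (Real.exp (-(r * max s 0))) else 0 := by
  rw [ageLaw, Measure.add_apply, Measure.smul_apply, Measure.dirac_apply' _ measurableSet_Ici,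
    withDensity_apply _ measurableSet_Ici, Measure.restrict_restrict measurableSet_Ici]
  split_ifs with h
  · have h1 : (Ici s ∩ Ioc 0 (t : ℝ) : Set ℝ) =ᵐ[volume] Ioc (max s 0) t := by
      have : (Ioc (max s 0) t : Set ℝ) = Ioi s ∩ Ioc 0 (t : ℝ) := by
        ext x; simp only [mem_Ioc, mem_inter_iff, mem_Ioi, max_lt_iff]; tauto
      rw [this]
      exact (Ioi_ae_eq_Ici (μ := volume) (a := s)).symm.inter (ae_eq_refl _)
    rw [Measure.restrict_congr_set h1, lintegral_exp_density r (max_le h t.2)]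
    simp only [indicator, mem_Ici, h, if_true, Pi.one_apply, smul_eq_mul, mul_one]
    have h2 : Real.exp (-(r * t)) ≤ Real.exp (-(r * max s 0)) := by
      gcongr
      exact max_le h t.2
    rw [← ENNReal.ofReal_add (by positivity) (sub_nonneg.2 h2)]
    congr 1; ring
  · have : (Ici s ∩ Ioc 0 (t : ℝ) : Set ℝ) = ∅ := by
      ext x; simp only [mem_Ioc, mem_inter_iff, mem_Ici, mem_empty_iff_false, iff_false]
      rintro ⟨h1, _, h3⟩; exact h (h1.trans h3)
    simp [this, h]

instance isProbabilityMeasure_ageLaw (r t : ℝ≥0) : IsProbabilityMeasure (ageLaw r t) := by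
  constructor
  have h : ageLaw r t (Iio 0) = 0 := by
    rw [ageLaw, Measure.add_apply, Measure.smul_apply, Measure.dirac_apply' _ measurableSet_Iio,
      withDensity_apply _ measurableSet_Iio, Measure.restrict_restrict measurableSet_Iio]
    have : (Iio 0 ∩ Ioc 0 (t : ℝ) : Set ℝ) = ∅ := by
      ext x; simp only [mem_Ioc, mem_inter_iff, mem_Iio, mem_empty_iff_false, iff_false]
      rintro ⟨h1, h2, _⟩; exact lt_asymm h1 h2
    simp [this]
  have h' := ageLaw_Ici r t 0
  rw [if_pos t.coe_nonneg] at h'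
  rw [← Iio_union_Ici (a := (0 : ℝ)), measure_union (Iio_disjoint_Ici le_rfl)
    measurableSet_Ici, h, h']
  simp

variable {Ω : Type*} [MeasurableSpace Ω] {P : Measure Ω}
  {N : ℝ≥0 → Ω → ℕ} {r : ℝ≥0}

lemma IsPoissonProcess.measurable_path (hN : IsPoissonProcess N r P) :
    Measurable (fun ω t ↦ N t ω) := measurable_pi_lambda _ hN.measurable

lemma IsPoissonProcess.measure_no_jump (hN : IsPoissonProcess N r P) {s t : ℝ≥0} (hst : s ≤ t) :
    P {ω | N t ω ≤ N s ω} = ENNReal.ofReal (Real.exp (-(r * (t - s)))) := by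
  have h := (hN.hasLaw_increments s t hst)
  have h1 : P ((fun ω ↦ N t ω - N s ω) ⁻¹' {0}) = poissonMeasure (r * (t - s)) {0} := by
    rw [← h.map_eq, Measure.map_apply_of_aemeasurable h.aemeasurable (measurableSet_singleton _)]
  rw [poissonMeasure_singleton] at h1
  simpa [Set.preimage, Nat.sub_eq_zero_iff_le, NNReal.coe_sub hst] using h1

/-- The time since the last reset has law `ageLaw`: it is at least `s` exactly when there is no
jump in `(t - s, t]`. -/
lemma IsPoissonProcess.map_age [IsProbabilityMeasure P] (hN : IsPoissonProcess N r P) (t : ℝ≥0) :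
    P.map (fun ω ↦ dist t (lastJump t fun s ↦ N s ω)) = ageLaw r t := by
  have hm : Measurable (fun ω ↦ dist t (lastJump t fun s ↦ N s ω)) :=
    measurable_const.dist ((measurable_lastJump t).comp hN.measurable_path)
  have := Measure.isProbabilityMeasure_map (μ := P) hm.aemeasurable
  refine Measure.ext_of_Ici _ _ fun s ↦ ?_
  rw [Measure.map_apply hm measurableSet_Ici, ageLaw_Ici]
  have key : ∀ᵐ ω ∂P, s ≤ dist t (lastJump t fun s ↦ N s ω) ↔
      s ≤ t ∧ N t ω ≤ N (t - s.toNNReal) ω := by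
    filter_upwards [hN.mono, hN.rightCont] with ω h1 h2
    rw [lastJump_eq h1 h2, ← jumpTime_le_iff h1 h2]
    have h3 : jumpTime (fun s ↦ N s ω) (N t ω) ≤ t := jumpTime_le le_rfl
    rw [NNReal.dist_eq, abs_of_nonneg (sub_nonneg.2 (by exact_mod_cast h3))]
    rw [← NNReal.coe_le_coe]
    rcases le_total s 0 with hs | hs
    · have h4 : (jumpTime (fun s ↦ N s ω) (N t ω) : ℝ) ≤ t := by exact_mod_cast h3
      simp only [Real.toNNReal_of_nonpos hs, tsub_zero, h4, and_true]
      constructor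
      · intro; exact hs.trans t.2
      · intro; linarith
    · by_cases hst : s ≤ t
      · rw [NNReal.coe_sub (by rwa [Real.toNNReal_le_iff_le_coe]), Real.coe_toNNReal _ hs]
        constructor
        · intro h; exact ⟨hst, by linarith⟩
        · intro h; linarith [h.2]
      · have := (jumpTime (fun s ↦ N s ω) (N t ω)).2
        constructor
        · intro h; exact absurd (h.trans (sub_le_self _ this)) hst
        · intro h; exact absurd h.1 hst
  have key' : ((fun ω ↦ dist t (lastJump t fun s ↦ N s ω)) ⁻¹' Ici s : Set Ω) =ᵐ[P]
      {ω | s ≤ t ∧ N t ω ≤ N (t - s.toNNReal) ω} := by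
    filter_upwards [key] with ω hω using propext hω
  rw [measure_congr key']
  split_ifs with h
  · have h1 : s.toNNReal ≤ t := by rwa [Real.toNNReal_le_iff_le_coe]
    simp only [h, true_and]
    rw [hN.measure_no_jump tsub_le_self, NNReal.coe_sub h1, Real.coe_toNNReal']
    congr 3; ring
  · simp [h]

end AgeLaw

/-! ### The law of the solution -/

section Law

/-- Evaluation `(w, s) ↦ w s` of continuous paths, in a form that is jointly measurable for the
product σ-algebra on the space of all paths: values on the grids `ℕ / k` are used. -/
noncomputable def pathEval (w : ℝ≥0 → ℝ) (s : ℝ≥0) : ℝ :=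
  limsup (fun k : ℕ ↦ w (⌈s * k⌉₊ / k)) atTop

lemma measurable_pathEval : Measurable (fun p : (ℝ≥0 → ℝ) × ℝ≥0 ↦ pathEval p.1 p.2) := by
  refine Measurable.limsup fun k ↦ ?_
  have h1 : Measurable (fun q : (ℝ≥0 → ℝ) × ℕ ↦ q.1 (q.2 / k)) :=
    measurable_from_prod_countable_left fun n ↦ measurable_pi_apply ((n : ℝ≥0) / k)
  exact h1.comp (measurable_fst.prodMk (Nat.measurable_ceil.comp (measurable_snd.mul_const _)))

lemma pathEval_eq {w : ℝ≥0 → ℝ} (hw : Continuous w) (s : ℝ≥0) : pathEval w s = w s := by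
  refine Tendsto.limsup_eq ((hw.tendsto s).comp ?_)
  rw [← NNReal.tendsto_coe]
  have := (tendsto_nat_ceil_mul_div_atTop (R := ℝ) s.2).comp tendsto_natCast_atTop_atTop
  refine this.congr fun k ↦ ?_
  simp only [Function.comp_apply, NNReal.coe_div, NNReal.coe_natCast]
  rfl

variable {Ω : Type*} [MeasurableSpace Ω] {P : Measure Ω} {W : ℝ≥0 → Ω → ℝ} {N : ℝ≥0 → Ω → ℕ}
  {r : ℝ≥0} {xR x₀ : ℝ} {X : ℝ≥0 → Ω → ℝ}

/-- The position after time `a` since the last reset and a standard normal increment `z`, for the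
process started at `x₀` and observed at time `t`; `a = t` means that there was no reset. -/
noncomputable def ageState (xR x₀ : ℝ) (t : ℝ≥0) (p : ℝ × ℝ) : ℝ :=
  (if p.1 = t then x₀ else xR) + √p.1 * p.2

lemma measurable_ageState (t : ℝ≥0) : Measurable (ageState xR x₀ t) := by
  refine Measurable.add (Measurable.ite ?_ measurable_const measurable_const) (by fun_prop)
  exact measurableSet_eq_fun measurable_fst measurable_const

/-- The state at time `t` when the Brownian path is `w` and the last jump time is `l`. -/
noncomputable def pathState (xR x₀ : ℝ) (t : ℝ≥0) (p : (ℝ≥0 → ℝ) × ℝ≥0) : ℝ :=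
  (if dist t p.2 = t then x₀ else xR) + (p.1 t - pathEval p.1 p.2)

lemma measurable_pathState (t : ℝ≥0) : Measurable (pathState xR x₀ t) := by
  refine Measurable.add (Measurable.ite ?_ measurable_const measurable_const)
    (((measurable_pi_apply t).comp measurable_fst).sub measurable_pathEval)
  exact measurableSet_eq_fun (measurable_const.dist measurable_snd) measurable_const

/-- The solution as an explicit measurable function of the paths of `W` and `N`. -/
lemma IsResettingSolution.ae_eq (hW : IsBrownianReal W P) (hN : IsPoissonProcess N r P)
    (hX : IsResettingSolution P W N xR x₀ X) (t : ℝ≥0) :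
    ∀ᵐ ω ∂P, X t ω = pathState xR x₀ t (fun s ↦ W s ω, lastJump t fun s ↦ N s ω) := by
  filter_upwards [hX, hW.cont, hW.eval_zero_ae_eq_zero, hN.zero, hN.mono, hN.rightCont,
    hN.unitJumps] with ω h1 h2 h3 h4 h5 h6 h7
  rw [pathState, pathEval_eq h2, lastJump_eq h5 h6, eq_restarted h4 h5 h6 h7 h2 h3 h1.2.2 t]
  have h8 : (jumpTime (fun s ↦ N s ω) (N t ω) : ℝ) ≤ t := by exact_mod_cast jumpTime_le le_rfl
  have h9 : dist t (jumpTime (fun s ↦ N s ω) (N t ω)) = t ↔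
      jumpTime (fun s ↦ N s ω) (N t ω) = 0 := by
    rw [NNReal.dist_eq, abs_of_nonneg (sub_nonneg.2 h8), sub_eq_self, NNReal.coe_eq_zero]
  simp only [h9]

lemma map_brownian_sub (hW : IsBrownianReal W P) (s t : ℝ≥0) :
    P.map (fun ω ↦ W t ω - W s ω) = (gaussianReal 0 1).map (fun z ↦ √(dist t s) * z) := by
  have h := (hW.hasLaw_sub t s).map_eq
  rw [gaussianReal_map_const_mul, mul_zero, mul_one]
  refine h.trans (congrArg _ ?_)
  ext
  simp [NNReal.dist_eq, Real.sq_sqrt, Real.dist_eq]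

lemma IsResettingSolution.aemeasurable (hWm : ∀ t, Measurable (W t)) (hW : IsBrownianReal W P)
    (hN : IsPoissonProcess N r P) (hX : IsResettingSolution P W N xR x₀ X) (t : ℝ≥0) :
    AEMeasurable (X t) P := by
  refine ⟨_, (measurable_pathState t).comp ?_, hX.ae_eq hW hN t⟩
  exact (measurable_pi_lambda _ hWm).prodMk ((measurable_lastJump t).comp hN.measurable_path)

/-- The last jump time is independent of the Brownian path, so it may be frozen, and the Brownian
increment since then is normal with variance the time since the last reset. -/
theorem IsResettingSolution.map_eq [IsProbabilityMeasure P] (hWm : ∀ t, Measurable (W t))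
    (hW : IsBrownianReal W P)
    (hN : IsPoissonProcess N r P) (hWN : IndepFun (fun ω t ↦ W t ω) (fun ω t ↦ N t ω) P)
    (hX : IsResettingSolution P W N xR x₀ X) (t : ℝ≥0) :
    P.map (X t) = ((ageLaw r t).prod (gaussianReal 0 1)).map (ageState xR x₀ t) := by
  have hWp : Measurable (fun ω t ↦ W t ω) := measurable_pi_lambda _ hWm
  have hL : Measurable (fun ω ↦ lastJump t fun s ↦ N s ω) :=
    (measurable_lastJump t).comp hN.measurable_path
  have hind : IndepFun (fun ω t ↦ W t ω) (fun ω ↦ lastJump t fun s ↦ N s ω) P :=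
    hWN.comp measurable_id (measurable_lastJump t)
  have hprod := hind.map_prod_eq_prod_map_map hWp.aemeasurable hL.aemeasurable
  have := Measure.isProbabilityMeasure_map (μ := P) hL.aemeasurable
  have := Measure.isProbabilityMeasure_map (μ := P) hWp.aemeasurable
  refine Measure.ext_of_lintegral _ fun f hf ↦ ?_
  have hfΦ : Measurable fun p ↦ f (pathState xR x₀ t p) := hf.comp (measurable_pathState t)
  have hfA : Measurable fun p ↦ f (ageState xR x₀ t p) := hf.comp (measurable_ageState t)
  calc ∫⁻ x, f x ∂P.map (X t)
      = ∫⁻ ω, f (pathState xR x₀ t (fun s ↦ W s ω, lastJump t fun s ↦ N s ω)) ∂P := by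
        rw [lintegral_map' hf.aemeasurable (hX.aemeasurable hWm hW hN t)]
        refine lintegral_congr_ae ?_
        filter_upwards [hX.ae_eq hW hN t] with ω hω
        rw [hω]
    _ = ∫⁻ p, f (pathState xR x₀ t p)
          ∂(P.map (fun ω ↦ ((fun s ↦ W s ω), lastJump t fun s ↦ N s ω))) := by
        rw [lintegral_map hfΦ (hWp.prodMk hL)]
    _ = ∫⁻ l, ∫⁻ w, f (pathState xR x₀ t (w, l)) ∂(P.map fun ω t ↦ W t ω)
          ∂(P.map fun ω ↦ lastJump t fun s ↦ N s ω) := by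
        rw [hprod, lintegral_prod_symm' _ hfΦ]
    _ = ∫⁻ l, ∫⁻ z, f (ageState xR x₀ t (dist t l, z)) ∂(gaussianReal 0 1)
          ∂(P.map fun ω ↦ lastJump t fun s ↦ N s ω) := by
        refine lintegral_congr fun l ↦ ?_
        set c := if dist t l = t then x₀ else xR with hc
        have hfc : Measurable fun y ↦ f (c + y) := hf.comp (measurable_const.add measurable_id)
        have hfl : Measurable fun w ↦ f (pathState xR x₀ t (w, l)) :=
          hfΦ.comp measurable_prodMk_right
        rw [lintegral_map hfl hWp]
        have h1 : ∫⁻ ω, f (pathState xR x₀ t (fun t ↦ W t ω, l)) ∂P =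
            ∫⁻ ω, f (c + (W t ω - W l ω)) ∂P := by
          refine lintegral_congr_ae ?_
          filter_upwards [hW.cont] with ω hω
          simp only [pathState, pathEval_eq hω, hc]
        have hsub : Measurable fun ω ↦ W t ω - W l ω := (hWm t).sub (hWm l)
        rw [h1, ← lintegral_map (f := fun y ↦ f (c + y)) hfc hsub,
          map_brownian_sub hW, lintegral_map hfc (by fun_prop)]
        rfl
    _ = ∫⁻ a, ∫⁻ z, f (ageState xR x₀ t (a, z)) ∂(gaussianReal 0 1) ∂(ageLaw r t) := by
        rw [← hN.map_age t, lintegral_map _ (measurable_const.dist hL),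
          lintegral_map _ hL]
        · exact (hfA.lintegral_prod_right').comp
            (measurable_const.dist measurable_id)
        · exact hfA.lintegral_prod_right'
    _ = ∫⁻ p, f (ageState xR x₀ t p) ∂((ageLaw r t).prod (gaussianReal 0 1)) := by
        rw [lintegral_prod _ hfA.aemeasurable]
    _ = _ := by rw [lintegral_map hf (measurable_ageState t)]

end Law

/-! ### The heat semigroup and the expectation formula -/

section Heat

/-- The heat semigroup `𝔼[g(x + √s Z)]`, `Z` standard normal. For `s ≤ 0` it is the identity. -/
noncomputable def heat (g : ℝ → ℝ) (s x : ℝ) : ℝ := ∫ z, g (x + √s * z) ∂(gaussianReal 0 1)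

/-- `g` grows at most exponentially. -/
def ExpGrowth (g : ℝ → ℝ) : Prop := ∃ C c : ℝ, ∀ x, |g x| ≤ C * Real.exp (c * |x|)

lemma ExpGrowth.of_bounded {g : ℝ → ℝ} (h : ∃ C, ∀ x, |g x| ≤ C) : ExpGrowth g := by
  obtain ⟨C, hC⟩ := h
  exact ⟨C, 0, by simpa using hC⟩

lemma ExpGrowth.exists_nonneg {g : ℝ → ℝ} (h : ExpGrowth g) :
    ∃ C c : ℝ, 0 ≤ C ∧ 0 ≤ c ∧ ∀ x, |g x| ≤ C * Real.exp (c * |x|) := by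
  obtain ⟨C, c, h⟩ := h
  refine ⟨|C|, |c|, abs_nonneg _, abs_nonneg _, fun x ↦ (h x).trans ?_⟩
  gcongr
  · exact le_abs_self C
  · exact le_abs_self c

variable {g : ℝ → ℝ}

/-- A dominating function for `g (x + √s * z)` that is uniform over bounded `x` and `s`. -/
lemma ExpGrowth.exists_bound (h : ExpGrowth g) (R T : ℝ) :
    ∃ C c : ℝ, 0 ≤ C ∧ 0 ≤ c ∧ ∀ x s z, |x| ≤ R → s ≤ T →
      |g (x + √s * z)| ≤ C * Real.exp (c * |z|) := by
  obtain ⟨C, c, hC, hc, h⟩ := h.exists_nonneg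
  refine ⟨C * Real.exp (c * R), c * √T, by positivity, by positivity,
    fun x s z hx hs ↦ (h _).trans ?_⟩
  rw [mul_assoc, ← Real.exp_add]
  have h1 : |x + √s * z| ≤ R + √T * |z| := by
    refine (abs_add_le _ _).trans ?_
    rw [abs_mul, abs_of_nonneg (Real.sqrt_nonneg s)]
    gcongr
  have h2 : c * |x + √s * z| ≤ c * R + c * √T * |z| := by
    calc c * |x + √s * z| ≤ c * (R + √T * |z|) := by gcongr
      _ = _ := by ring
  gcongr

lemma integrable_exp_mul_abs_gaussianReal (c : ℝ) :
    Integrable (fun z ↦ Real.exp (c * |z|)) (gaussianReal 0 1) :=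
  integrable_exp_mul_abs (integrable_exp_mul_gaussianReal c) (integrable_exp_mul_gaussianReal (-c))

lemma integrable_pow_mul_exp_gaussianReal (n : ℕ) (c : ℝ) :
    Integrable (fun z ↦ |z| ^ n * Real.exp (c * |z|)) (gaussianReal 0 1) := by
  refine ((integrable_exp_mul_abs_gaussianReal (1 + c)).const_mul (n.factorial : ℝ)).mono'
    (Continuous.aestronglyMeasurable (by fun_prop)) (Eventually.of_forall fun z ↦ ?_)
  rw [Real.norm_of_nonneg (by positivity), add_mul, Real.exp_add, ← mul_assoc, one_mul]
  gcongr
  have := Real.pow_div_factorial_le_exp |z| (abs_nonneg z) n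
  rwa [div_le_iff₀' (by positivity)] at this

lemma integrable_heat (hg : Continuous g) (h : ExpGrowth g) (s x : ℝ) :
    Integrable (fun z ↦ g (x + √s * z)) (gaussianReal 0 1) := by
  obtain ⟨C, c, -, -, h⟩ := h.exists_bound |x| s
  refine ((integrable_exp_mul_abs_gaussianReal c).const_mul C).mono'
    (Continuous.aestronglyMeasurable (by fun_prop)) (Eventually.of_forall fun z ↦ ?_)
  exact h x s z le_rfl le_rfl

lemma heat_zero (g : ℝ → ℝ) (x : ℝ) : heat g 0 x = g x := by simp [heat]

lemma continuous_heat (hg : Continuous g) (h : ExpGrowth g) (x : ℝ) :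
    Continuous (fun s ↦ heat g s x) := by
  refine continuous_iff_continuousAt.2 fun s ↦ ?_
  obtain ⟨C, c, -, -, h⟩ := h.exists_bound |x| (s + 1)
  refine continuousAt_of_dominated (bound := fun z ↦ C * Real.exp (c * |z|)) ?_ ?_
    ((integrable_exp_mul_abs_gaussianReal c).const_mul C) ?_
  · exact Eventually.of_forall fun s ↦ Continuous.aestronglyMeasurable (by fun_prop)
  · filter_upwards [Iio_mem_nhds (lt_add_one s)] with u hu
    exact Eventually.of_forall fun z ↦ h x u z le_rfl (le_of_lt hu)
  · exact Eventually.of_forall fun z ↦ Continuous.continuousAt (by fun_prop)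

/-- The renewal formula for `𝔼[g(X_t)]`: either there is no reset up to time `t`, or the last one
is at time `t - s`. -/
noncomputable def expectation (r xR : ℝ) (g : ℝ → ℝ) (x₀ t : ℝ) : ℝ :=
  Real.exp (-(r * t)) * heat g t x₀ + ∫ s in 0..t, r * Real.exp (-(r * s)) * heat g s xR

lemma ae_ageLaw_le (r t : ℝ≥0) : ∀ᵐ a ∂(ageLaw r t), a ≤ (t : ℝ) := by
  rw [ageLaw, ae_add_measure_iff]
  constructor
  · refine Measure.ae_smul_measure ?_ _
    rw [ae_dirac_iff measurableSet_Iic]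
  · refine (withDensity_absolutelyContinuous _ _).ae_le ?_
    filter_upwards [ae_restrict_mem measurableSet_Ioc] with a ha using ha.2

lemma integrable_comp_ageState (hg : Continuous g) (h : ExpGrowth g) (r t : ℝ≥0) (xR x₀ : ℝ) :
    Integrable (fun p ↦ g (ageState xR x₀ t p)) ((ageLaw r t).prod (gaussianReal 0 1)) := by
  obtain ⟨C, c, -, -, h⟩ := h.exists_bound (max |x₀| |xR|) t
  refine (((integrable_exp_mul_abs_gaussianReal c).const_mul C).comp_snd (ageLaw r t)).mono'
    (hg.measurable.comp (measurable_ageState t)).aestronglyMeasurable ?_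
  filter_upwards [Measure.quasiMeasurePreserving_fst.ae (ae_ageLaw_le r t)] with p hp
  refine h _ _ _ ?_ hp
  split_ifs
  · exact le_max_left _ _
  · exact le_max_right _ _

lemma integral_comp_ageState (hg : Continuous g) (h : ExpGrowth g) (r t : ℝ≥0) (xR x₀ : ℝ) :
    ∫ p, g (ageState xR x₀ t p) ∂((ageLaw r t).prod (gaussianReal 0 1)) =
      expectation r xR g x₀ t := by
  have hint := integrable_comp_ageState hg h r t xR x₀
  have hint' := hint.integral_prod_left
  rw [integral_prod _ hint]
  rw [ageLaw] at hint' ⊢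
  have hm : Measurable fun s : ℝ ↦ ENNReal.ofReal (r * Real.exp (-(r * s))) := by fun_prop
  rw [integral_add_measure hint'.left_of_add_measure hint'.right_of_add_measure,
    integral_smul_measure, integral_dirac, integral_withDensity_eq_integral_toReal_smul hm
      (Eventually.of_forall fun _ ↦ ENNReal.ofReal_lt_top), expectation,
    intervalIntegral.integral_of_le t.coe_nonneg]
  congr 1
  · simp [ageState, heat, (Real.exp_pos _).le]
  -- the value `t`, which marks the absence of a reset, is null for the continuous part
  · have h1 : ∀ᵐ s ∂(volume.restrict (Ioc 0 (t : ℝ))), s ≠ (t : ℝ) :=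
      ae_restrict_of_ae (Measure.ae_ne volume (t : ℝ))
    refine integral_congr_ae ?_
    filter_upwards [h1] with s hs
    rw [ENNReal.toReal_ofReal (by positivity), smul_eq_mul]
    simp [ageState, heat, hs]

variable {Ω : Type*} [MeasurableSpace Ω] {P : Measure Ω} [IsProbabilityMeasure P]
  {W : ℝ≥0 → Ω → ℝ} {N : ℝ≥0 → Ω → ℕ} {r : ℝ≥0} {xR x₀ : ℝ} {X : ℝ≥0 → Ω → ℝ}

lemma IsResettingSolution.integrable_comp (hWm : ∀ t, Measurable (W t)) (hW : IsBrownianReal W P)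
    (hN : IsPoissonProcess N r P) (hWN : IndepFun (fun ω t ↦ W t ω) (fun ω t ↦ N t ω) P)
    (hX : IsResettingSolution P W N xR x₀ X) (hg : Continuous g) (h : ExpGrowth g) (t : ℝ≥0) :
    Integrable (fun ω ↦ g (X t ω)) P := by
  have h1 := integrable_comp_ageState hg h r t xR x₀
  rw [← Function.comp_def, ← integrable_map_measure hg.aestronglyMeasurable
    (measurable_ageState t).aemeasurable, ← hX.map_eq hWm hW hN hWN,
    integrable_map_measure hg.aestronglyMeasurable (hX.aemeasurable hWm hW hN t)] at h1
  exact h1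

theorem IsResettingSolution.integral_comp (hWm : ∀ t, Measurable (W t)) (hW : IsBrownianReal W P)
    (hN : IsPoissonProcess N r P) (hWN : IndepFun (fun ω t ↦ W t ω) (fun ω t ↦ N t ω) P)
    (hX : IsResettingSolution P W N xR x₀ X) (hg : Continuous g) (h : ExpGrowth g) (t : ℝ≥0) :
    ∫ ω, g (X t ω) ∂P = expectation r xR g x₀ t := by
  rw [← integral_comp_ageState hg h, ← integral_map (measurable_ageState t).aemeasurable
    hg.aestronglyMeasurable, ← hX.map_eq hWm hW hN hWN,
    integral_map (hX.aemeasurable hWm hW hN t) hg.aestronglyMeasurable]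

/-- For `t > 0` the law of `X_t` is a mixture of normal laws of positive variance. -/
theorem IsResettingSolution.hasPDF (hWm : ∀ t, Measurable (W t)) (hW : IsBrownianReal W P)
    (hN : IsPoissonProcess N r P) (hWN : IndepFun (fun ω t ↦ W t ω) (fun ω t ↦ N t ω) P)
    (hX : IsResettingSolution P W N xR x₀ X) {t : ℝ≥0} (ht : 0 < t) :
    HasPDF (X t) P volume := by
  rw [Real.hasPDF_iff_of_aemeasurable (hX.aemeasurable hWm hW hN t), hX.map_eq hWm hW hN hWN]
  refine Measure.AbsolutelyContinuous.mk fun s hs hs0 ↦ ?_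
  rw [Measure.map_apply (measurable_ageState t) hs,
    Measure.measure_prod_null (measurable_ageState t hs)]
  have hpos : ∀ᵐ a ∂(ageLaw r t), 0 < a := by
    rw [ageLaw, ae_add_measure_iff]
    constructor
    · refine Measure.ae_smul_measure ?_ _
      rw [ae_dirac_iff measurableSet_Ioi]
      exact_mod_cast ht
    · refine (withDensity_absolutelyContinuous _ _).ae_le ?_
      filter_upwards [ae_restrict_mem measurableSet_Ioc] with a ha using ha.1
  filter_upwards [hpos] with a ha
  set c := if a = t then x₀ else xR with hc
  have h1 : (gaussianReal 0 1).map (fun z ↦ c + √a * z) ≪ volume := by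
    have h2 : (fun z ↦ c + √a * z) = (fun y ↦ c + y) ∘ (fun z ↦ √a * z) := rfl
    rw [h2, ← Measure.map_map (by fun_prop) (by fun_prop), gaussianReal_map_const_mul,
      gaussianReal_map_const_add]
    refine gaussianReal_absolutelyContinuous _ ?_
    rw [mul_one, ← NNReal.coe_ne_zero]
    exact pow_ne_zero 2 (Real.sqrt_pos.2 ha).ne'
  have h3 := h1 hs0
  rwa [Measure.map_apply (by fun_prop) hs] at h3

end Heat

/-! ### Second-order Taylor estimates and the generator -/

section Generator

variable {g : ℝ → ℝ}

lemma hasDerivAt_of_contDiff_two (hg : ContDiff ℝ 2 g) (x : ℝ) : HasDerivAt g (deriv g x) x :=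
  (hg.differentiable (by norm_num) x).hasDerivAt

lemma hasDerivAt_deriv_of_contDiff_two (hg : ContDiff ℝ 2 g) (x : ℝ) :
    HasDerivAt (deriv g) (iteratedDeriv 2 g x) x := by
  have h : Differentiable ℝ (iteratedDeriv 1 g) := hg.differentiable_iteratedDeriv 1 (by norm_num)
  rw [iteratedDeriv_one] at h
  rw [iteratedDeriv_succ, iteratedDeriv_one]
  exact (h x).hasDerivAt

lemma continuous_iteratedDeriv_two (hg : ContDiff ℝ 2 g) : Continuous (iteratedDeriv 2 g) :=
  hg.continuous_iteratedDeriv 2 le_rfl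

/-- The remainder of the second-order Taylor expansion of `g` at `x`. -/
noncomputable def taylorRem (g : ℝ → ℝ) (x y : ℝ) : ℝ :=
  g (x + y) - g x - deriv g x * y - 1 / 2 * iteratedDeriv 2 g x * y ^ 2

/-- The mean value inequality, applied to the remainder and to its derivative. -/
lemma abs_taylorRem_le (hg : ContDiff ℝ 2 g) {x y M : ℝ}
    (h : ∀ u, |u| ≤ |y| → |iteratedDeriv 2 g (x + u) - iteratedDeriv 2 g x| ≤ M) :
    |taylorRem g x y| ≤ M * y ^ 2 := by
  have hM : 0 ≤ M := (abs_nonneg _).trans (h 0 (by simp))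
  have hconv : Convex ℝ {u : ℝ | |u| ≤ |y|} := by
    have : {u : ℝ | |u| ≤ |y|} = Icc (-|y|) |y| := by ext u; simp [abs_le]
    rw [this]; exact convex_Icc _ _
  have hmem : (0 : ℝ) ∈ {u : ℝ | |u| ≤ |y|} := by simp
  have hadd : ∀ u, HasDerivAt (fun u ↦ x + u) 1 u := fun u ↦ (hasDerivAt_id' u).const_add x
  have h1 : ∀ u, |u| ≤ |y| → |deriv g (x + u) - deriv g x - iteratedDeriv 2 g x * u| ≤ M * |y| := by
    intro u hu
    have hd : ∀ v, HasDerivAt (fun v ↦ deriv g (x + v) - deriv g x - iteratedDeriv 2 g x * v)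
        (iteratedDeriv 2 g (x + v) - iteratedDeriv 2 g x) v := by
      intro v
      have h2 := ((hasDerivAt_deriv_of_contDiff_two hg (x + v)).comp v (hadd v)).sub_const
        (deriv g x) |>.fun_sub ((hasDerivAt_id' v).const_mul (iteratedDeriv 2 g x))
      simpa using h2
    have h2 := hconv.norm_image_sub_le_of_norm_hasDerivWithin_le (x := 0) (y := u)
      (fun v _ ↦ (hd v).hasDerivWithinAt) (fun v hv ↦ h v hv) hmem hu
    simp only [add_zero, sub_self, mul_zero, sub_zero, Real.norm_eq_abs] at h2
    exact h2.trans (by gcongr)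
  have hd : ∀ v, HasDerivAt (taylorRem g x)
      (deriv g (x + v) - deriv g x - iteratedDeriv 2 g x * v) v := by
    intro v
    have h2 := (((hasDerivAt_of_contDiff_two hg (x + v)).comp v (hadd v)).sub_const (g x)).sub
      ((hasDerivAt_id' v).const_mul (deriv g x)) |>.sub
      ((hasDerivAt_pow 2 v).const_mul (1 / 2 * iteratedDeriv 2 g x))
    exact h2.congr_deriv (by push_cast; ring)
  have h2 := hconv.norm_image_sub_le_of_norm_hasDerivWithin_le (x := 0) (y := y)
      (fun v _ ↦ (hd v).hasDerivWithinAt) (fun v hv ↦ h1 v hv) hmem (le_refl |y|)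
  have h3 : taylorRem g x 0 = 0 := by simp [taylorRem]
  rw [h3, sub_zero, sub_zero, Real.norm_eq_abs, Real.norm_eq_abs, mul_assoc, ← sq, sq_abs] at h2
  exact h2

/-- On `S`, the Taylor remainder is `o(y²)` uniformly, with a controlled growth at infinity. -/
def UniformTaylor (g : ℝ → ℝ) (S : Set ℝ) : Prop :=
  ∀ ε > 0, ∃ K c : ℝ, 0 ≤ K ∧ 0 ≤ c ∧ ∀ x ∈ S, ∀ y,
    |taylorRem g x y| ≤ ε * y ^ 2 + K * (|y| ^ 3 * Real.exp (c * |y|))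

/-- Away from `x` the remainder is only bounded by an exponential, which `|y| ≥ δ` turns into
`|y|³ e^{c|y|}`; this is why no growth condition on the derivatives is needed. -/
lemma uniformTaylor_singleton (hg : ContDiff ℝ 2 g) (h : ExpGrowth g) (x : ℝ) :
    UniformTaylor g {x} := by
  intro ε hε
  obtain ⟨δ, hδ, hcont⟩ := Metric.continuousAt_iff.1
    ((continuous_iteratedDeriv_two hg).continuousAt (x := x)) ε hε
  obtain ⟨C, c, hC, hc, hb⟩ := h.exists_bound |x| 1
  set A := C + |g x| + |deriv g x| + |iteratedDeriv 2 g x| with hA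
  refine ⟨A / δ ^ 3, c + 1, by positivity, by positivity, ?_⟩
  intro x' hx' y
  obtain rfl : x = x' := (mem_singleton_iff.1 hx').symm
  rcases lt_or_ge |y| δ with hy | hy
  · have h1 : |taylorRem g x y| ≤ ε * y ^ 2 := by
      refine abs_taylorRem_le hg fun u hu ↦ ?_
      have := hcont (x := x + u) (by simpa [Real.dist_eq] using hu.trans_lt hy)
      exact (Real.dist_eq _ _ ▸ this).le
    exact h1.trans (le_add_of_nonneg_right (by positivity))
  · have e1 : (1 : ℝ) ≤ Real.exp ((c + 1) * |y|) := Real.one_le_exp (by positivity)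
    have e0 : Real.exp (c * |y|) ≤ Real.exp ((c + 1) * |y|) :=
      Real.exp_le_exp.2 (by nlinarith [abs_nonneg y])
    have e0' : Real.exp |y| ≤ Real.exp ((c + 1) * |y|) :=
      Real.exp_le_exp.2 (by nlinarith [abs_nonneg y, mul_nonneg hc (abs_nonneg y)])
    have e2 : |y| ≤ Real.exp ((c + 1) * |y|) :=
      le_trans (by linarith [Real.add_one_le_exp |y|]) e0'
    have e3 : 1 / 2 * y ^ 2 ≤ Real.exp ((c + 1) * |y|) := by
      have := Real.pow_div_factorial_le_exp |y| (abs_nonneg y) 2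
      rw [sq_abs, Nat.factorial_two] at this
      refine le_trans ?_ e0'
      push_cast at this
      linarith
    have h1 : |taylorRem g x y| ≤ A * Real.exp ((c + 1) * |y|) := by
      have h2 : |taylorRem g x y| ≤ |g (x + y)| + |g x| + |deriv g x| * |y| +
          |iteratedDeriv 2 g x| * (1 / 2 * y ^ 2) := by
        rw [taylorRem]
        refine (abs_sub _ _).trans (add_le_add ((abs_sub _ _).trans
          (add_le_add (abs_sub _ _) ?_)) ?_)
        · rw [abs_mul]
        · rw [abs_mul, abs_mul, abs_of_nonneg (sq_nonneg y),
            abs_of_nonneg (by norm_num : (0 : ℝ) ≤ 1 / 2)]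
          apply le_of_eq; ring
      have h3 : |g (x + y)| ≤ C * Real.exp ((c + 1) * |y|) := by
        have := hb x 1 y le_rfl le_rfl
        rw [Real.sqrt_one, one_mul] at this
        exact this.trans (by gcongr)
      have h4 : |g x| ≤ |g x| * Real.exp ((c + 1) * |y|) := le_mul_of_one_le_right (abs_nonneg _) e1
      have h5 := mul_le_mul_of_nonneg_left e2 (abs_nonneg (deriv g x))
      have h6 := mul_le_mul_of_nonneg_left e3 (abs_nonneg (iteratedDeriv 2 g x))
      rw [hA, add_mul, add_mul, add_mul]
      linarith
    have h7 : (1 : ℝ) ≤ |y| ^ 3 / δ ^ 3 := by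
      rw [one_le_div (by positivity)]
      gcongr
    have h8 : A * Real.exp ((c + 1) * |y|) ≤
        A / δ ^ 3 * (|y| ^ 3 * Real.exp ((c + 1) * |y|)) := by
      calc A * Real.exp ((c + 1) * |y|) ≤ A * Real.exp ((c + 1) * |y|) * (|y| ^ 3 / δ ^ 3) :=
            le_mul_of_one_le_right (by positivity) h7
        _ = _ := by ring
    exact (h1.trans h8).trans (le_add_of_nonneg_left (by positivity))

lemma uniformTaylor_univ (hg : ContDiff ℝ 2 g) (hb : ∃ C, ∀ x, |iteratedDeriv 2 g x| ≤ C)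
    (hu : UniformContinuous (iteratedDeriv 2 g)) : UniformTaylor g univ := by
  intro ε hε
  obtain ⟨M, hM⟩ := hb
  have hM0 : 0 ≤ M := (abs_nonneg _).trans (hM 0)
  obtain ⟨δ, hδ, hcont⟩ := Metric.uniformContinuous_iff.1 hu ε hε
  refine ⟨2 * M / δ, 0, by positivity, le_rfl, fun x _ y ↦ ?_⟩
  rcases lt_or_ge |y| δ with hy | hy
  · have h1 : |taylorRem g x y| ≤ ε * y ^ 2 := by
      refine abs_taylorRem_le hg fun u hu ↦ ?_
      have := hcont (a := x + u) (b := x) (by simpa [Real.dist_eq] using hu.trans_lt hy)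
      exact (Real.dist_eq _ _ ▸ this).le
    exact h1.trans (le_add_of_nonneg_right (by positivity))
  · have h1 : |taylorRem g x y| ≤ 2 * M * y ^ 2 := by
      refine abs_taylorRem_le hg fun u _ ↦ (abs_sub _ _).trans ?_
      linarith [hM (x + u), hM x]
    have h2 : 2 * M * y ^ 2 ≤ 2 * M / δ * (|y| ^ 3 * Real.exp (0 * |y|)) := by
      have h7 : (1 : ℝ) ≤ |y| / δ := by rwa [one_le_div hδ]
      calc 2 * M * y ^ 2 ≤ 2 * M * y ^ 2 * (|y| / δ) := le_mul_of_one_le_right (by positivity) h7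
        _ = _ := by rw [zero_mul, Real.exp_zero, ← sq_abs]; ring
    exact (h1.trans h2).trans (le_add_of_nonneg_left (by positivity))

lemma integral_sq_gaussianReal : ∫ z, z ^ 2 ∂(gaussianReal 0 1) = 1 := by
  have h := variance_of_integral_eq_zero (μ := gaussianReal 0 1) (X := fun z ↦ z)
    (by fun_prop) integral_id_gaussianReal
  rw [variance_fun_id_gaussianReal] at h
  simpa using h.symm

lemma integrable_pow_gaussianReal (n : ℕ) : Integrable (fun z ↦ z ^ n) (gaussianReal 0 1) := by
  refine (integrable_pow_mul_exp_gaussianReal n 0).mono' (by fun_prop)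
    (Eventually.of_forall fun z ↦ ?_)
  simp

lemma integral_taylorRem (hg : Continuous g) (h : ExpGrowth g) (x : ℝ) {t : ℝ} (ht : 0 ≤ t) :
    ∫ z, taylorRem g x (√t * z) ∂(gaussianReal 0 1) =
      heat g t x - g x - t * (1 / 2 * iteratedDeriv 2 g x) := by
  have i0 := integrable_heat hg h t x
  have i1 : Integrable (fun z : ℝ ↦ deriv g x * (√t * z)) (gaussianReal 0 1) := by
    simpa using ((integrable_pow_gaussianReal 1).const_mul (√t)).const_mul (deriv g x)
  have i2 : Integrable (fun z : ℝ ↦ 1 / 2 * iteratedDeriv 2 g x * (√t * z) ^ 2)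
      (gaussianReal 0 1) := by
    simpa [mul_pow] using ((integrable_pow_gaussianReal 2).const_mul (√t ^ 2)).const_mul
      (1 / 2 * iteratedDeriv 2 g x)
  have i3 : Integrable (fun z : ℝ ↦ g (x + √t * z) - g x) (gaussianReal 0 1) :=
    i0.sub (integrable_const _)
  have i4 : Integrable (fun z : ℝ ↦ g (x + √t * z) - g x - deriv g x * (√t * z))
    (gaussianReal 0 1) := i3.sub i1
  simp only [taylorRem]
  rw [integral_sub i4 i2, integral_sub i3 i1, integral_sub i0 (integrable_const _),
    integral_const_mul, integral_const_mul, integral_const_mul, integral_id_gaussianReal]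
  simp only [mul_pow]
  rw [integral_const_mul, integral_sq_gaussianReal, Real.sq_sqrt ht]
  simp [heat]
  ring

/-- The generator of Brownian motion, uniformly on `S`. -/
lemma UniformTaylor.heat_quotient {S : Set ℝ} (hS : UniformTaylor g S) (hg : Continuous g)
    (h : ExpGrowth g) {ε : ℝ} (hε : 0 < ε) :
    ∀ᶠ t in 𝓝[>] (0 : ℝ), ∀ x ∈ S,
      |(heat g t x - g x) / t - 1 / 2 * iteratedDeriv 2 g x| < ε := by
  obtain ⟨K, c, hK, hc, hb⟩ := hS (ε / 2) (half_pos hε)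
  set m := ∫ z, |z| ^ 3 * Real.exp (c * |z|) ∂(gaussianReal 0 1) with hm
  have hlim : Tendsto (fun t ↦ K * √t * m) (𝓝[>] (0 : ℝ)) (𝓝 0) := by
    have : Continuous fun t ↦ K * √t * m := by fun_prop
    simpa using (this.tendsto 0).mono_left nhdsWithin_le_nhds
  filter_upwards [hlim.eventually_lt_const (half_pos hε), self_mem_nhdsWithin,
    mem_nhdsWithin_of_mem_nhds (Iic_mem_nhds zero_lt_one)] with t h1 ht ht1 x hx
  simp only [mem_Ioi, mem_Iic] at ht ht1
  have hs0 : 0 ≤ √t := Real.sqrt_nonneg t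
  have hs1 : √t ≤ 1 := Real.sqrt_le_one.2 ht1
  have hst : √t ^ 2 = t := Real.sq_sqrt ht.le
  have e : (heat g t x - g x) / t - 1 / 2 * iteratedDeriv 2 g x =
      (∫ z, taylorRem g x (√t * z) ∂(gaussianReal 0 1)) / t := by
    rw [integral_taylorRem hg h x ht.le]
    field_simp
  rw [e, abs_div, abs_of_pos ht, div_lt_iff₀ ht]
  have i1 := ((integrable_pow_gaussianReal 2).const_mul (ε / 2 * t))
  have i2 := ((integrable_pow_mul_exp_gaussianReal 3 c).const_mul (K * √t ^ 3))
  calc |∫ z, taylorRem g x (√t * z) ∂(gaussianReal 0 1)|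
      ≤ ∫ z, (ε / 2 * t * z ^ 2 + K * √t ^ 3 * (|z| ^ 3 * Real.exp (c * |z|)))
          ∂(gaussianReal 0 1) := by
        rw [← Real.norm_eq_abs]
        refine norm_integral_le_of_norm_le (i1.add i2) (Eventually.of_forall fun z ↦ ?_)
        refine (hb x hx (√t * z)).trans ?_
        rw [abs_mul, abs_of_nonneg hs0, mul_pow, mul_pow, hst]
        have h2 : Real.exp (c * (√t * |z|)) ≤ Real.exp (c * |z|) := by
          apply Real.exp_le_exp.2
          gcongr
          exact mul_le_of_le_one_left (abs_nonneg z) hs1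
        calc _ = ε / 2 * t * z ^ 2 + K * √t ^ 3 * (|z| ^ 3 * Real.exp (c * (√t * |z|))) := by ring
          _ ≤ _ := by gcongr
    _ = ε / 2 * t + K * √t * m * t := by
        rw [integral_add i1 i2, integral_const_mul, integral_const_mul, integral_sq_gaussianReal,
          ← hm, pow_succ, hst]
        ring
    _ < ε * t := by nlinarith

/-- The generator of the process with resetting, uniformly on `S`, in terms of the renewal
formula. -/
lemma UniformTaylor.expectation_quotient {S : Set ℝ} (hS : UniformTaylor g S) (hg : Continuous g)
    (h : ExpGrowth g) {B : ℝ} (hB : ∀ x ∈ S, |g x| ≤ B)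
    (hB2 : ∀ x ∈ S, |iteratedDeriv 2 g x| ≤ B) (r : ℝ≥0) (xR : ℝ) {ε : ℝ} (hε : 0 < ε) :
    ∀ᶠ t in 𝓝[>] (0 : ℝ), ∀ x ∈ S,
      |(expectation r xR g x t - g x) / t - resettingOperator r xR g x| < ε := by
  have d1 : HasDerivAt (fun t : ℝ ↦ Real.exp (-(r * t))) (-r) 0 := by
    simpa using (((hasDerivAt_id' (0 : ℝ)).const_mul (r : ℝ)).fun_neg.exp)
  have hcont : Continuous fun s ↦ r * Real.exp (-(r * s)) * heat g s xR := by
    have := continuous_heat hg h xR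
    fun_prop
  have d2 := (hcont.integral_hasStrictDerivAt 0 0).hasDerivAt
  -- the error terms: the killing factor, its derivative, and the contribution of the resets
  have l1 : Tendsto (fun t : ℝ ↦ |Real.exp (-(r * t)) - 1| * B) (𝓝[>] 0) (𝓝 0) := by
    have : Continuous fun t : ℝ ↦ |Real.exp (-(r * t)) - 1| * B := by fun_prop
    simpa using (this.tendsto 0).mono_left nhdsWithin_le_nhds
  have l2 : Tendsto (fun t : ℝ ↦ |(Real.exp (-(r * t)) - 1) / t + r| * B) (𝓝[>] 0) (𝓝 0) := by
    have := (((d1.tendsto_slope_zero_right).add_const (r : ℝ)).abs).mul_const B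
    simpa [div_eq_inv_mul] using this
  have l3 : Tendsto (fun t : ℝ ↦
      |(∫ s in 0..t, r * Real.exp (-(r * s)) * heat g s xR) / t - r * g xR|) (𝓝[>] 0) (𝓝 0) := by
    have := ((d2.tendsto_slope_zero_right).sub_const (r * g xR)).abs
    simpa [div_eq_inv_mul, heat_zero] using this
  have hsum := ((l1.add l2).add l3)
  simp only [add_zero] at hsum
  filter_upwards [hS.heat_quotient hg h (half_pos hε), hsum.eventually_lt_const (half_pos hε),
    self_mem_nhdsWithin] with t h1 h2 ht x hx
  simp only [mem_Ioi] at ht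
  have hE0 : |Real.exp (-(r * t))| ≤ 1 := by
    rw [abs_of_pos (Real.exp_pos _), Real.exp_le_one_iff]
    have := mul_nonneg r.coe_nonneg ht.le
    linarith
  have e : (expectation r xR g x t - g x) / t - resettingOperator r xR g x =
      Real.exp (-(r * t)) * ((heat g t x - g x) / t - 1 / 2 * iteratedDeriv 2 g x) +
      (Real.exp (-(r * t)) - 1) * (1 / 2 * iteratedDeriv 2 g x) +
      ((Real.exp (-(r * t)) - 1) / t + r) * g x +
      ((∫ s in 0..t, r * Real.exp (-(r * s)) * heat g s xR) / t - r * g xR) := by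
    rw [expectation, resettingOperator]
    field_simp
    ring
  rw [e]
  refine lt_of_le_of_lt ((abs_add_le _ _).trans (add_le_add_left ((abs_add_le _ _).trans
    (add_le_add_left (abs_add_le _ _) _)) _)) ?_
  simp only [abs_mul]
  have b1 := mul_le_mul hE0 (h1 x hx).le (abs_nonneg _) zero_le_one
  have b2 : |(1 / 2 : ℝ)| * |iteratedDeriv 2 g x| ≤ B := by
    rw [abs_of_pos (by norm_num)]
    linarith [hB2 x hx, abs_nonneg (iteratedDeriv 2 g x)]
  have b3 := mul_le_mul_of_nonneg_left b2 (abs_nonneg (Real.exp (-(r * t)) - 1))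
  have b4 := mul_le_mul_of_nonneg_left (hB x hx) (abs_nonneg ((Real.exp (-(r * t)) - 1) / t + r))
  linarith

end Generator

/-! ### The evolution equation for expectations -/

section Evolution

lemma hasDerivAt_gaussianPDFReal (z : ℝ) :
    HasDerivAt (gaussianPDFReal 0 1) (-z * gaussianPDFReal 0 1 z) z := by
  have h1 : HasDerivAt (fun z : ℝ ↦ -(z - 0) ^ 2 / (2 * ((1 : ℝ≥0) : ℝ))) (-z) z := by
    have := (((hasDerivAt_id' z).sub_const 0).fun_pow 2).fun_neg.div_const (2 * ((1 : ℝ≥0) : ℝ))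
    exact this.congr_deriv (by simp; ring)
  have h2 := h1.exp.const_mul ((√(2 * Real.pi * (1 : ℝ≥0)))⁻¹)
  have h3 : gaussianPDFReal 0 1 = fun z ↦ (√(2 * Real.pi * (1 : ℝ≥0)))⁻¹ *
    Real.exp (-(z - 0) ^ 2 / (2 * ((1 : ℝ≥0) : ℝ))) := rfl
  rw [h3]
  exact h2.congr_deriv (by ring)

lemma integrable_gaussianPDFReal_mul {f : ℝ → ℝ} (hf : Integrable f (gaussianReal 0 1)) :
    Integrable (fun z ↦ gaussianPDFReal 0 1 z * f z) := by
  rw [gaussianReal_of_var_ne_zero _ one_ne_zero, integrable_withDensity_iff_integrable_smul'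
    (measurable_gaussianPDF 0 1) (Eventually.of_forall fun _ ↦ gaussianPDF_lt_top)] at hf
  simpa using hf

/-- **Stein's lemma**: Gaussian integration by parts. -/
lemma integral_mul_gaussianReal_eq_integral_deriv {u u' : ℝ → ℝ} (hu : ∀ z, HasDerivAt u (u' z) z)
    (h0 : Integrable u (gaussianReal 0 1)) (h1 : Integrable (fun z ↦ u z * z) (gaussianReal 0 1))
    (h2 : Integrable u' (gaussianReal 0 1)) :
    ∫ z, u z * z ∂(gaussianReal 0 1) = ∫ z, u' z ∂(gaussianReal 0 1) := by
  have i0 := integrable_gaussianPDFReal_mul h0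
  have i1 := integrable_gaussianPDFReal_mul h1
  have i2 := integrable_gaussianPDFReal_mul h2
  have key := integral_mul_deriv_eq_deriv_mul_of_integrable (u := u) (v := gaussianPDFReal 0 1)
    (fun z _ ↦ hu z) (fun z _ ↦ hasDerivAt_gaussianPDFReal z)
    (i1.neg.congr (Eventually.of_forall fun z ↦ by simp; ring))
    (i2.congr (Eventually.of_forall fun z ↦ by simp; ring))
    (i0.congr (Eventually.of_forall fun z ↦ by simp; ring))
  rw [integral_gaussianReal_eq_integral_smul one_ne_zero,
    integral_gaussianReal_eq_integral_smul one_ne_zero]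
  simp only [smul_eq_mul]
  have e1 : ∀ z, u z * (-z * gaussianPDFReal 0 1 z) = -(gaussianPDFReal 0 1 z * (u z * z)) :=
    fun z ↦ by ring
  simp only [e1, integral_neg, neg_inj] at key
  rw [key]
  simp only [mul_comm]

variable {g : ℝ → ℝ}

/-- The heat equation `∂ₛ heat g = ½ heat g''`, by differentiation under the integral sign and
Stein's lemma. -/
lemma hasDerivAt_heat (hg : ContDiff ℝ 2 g) (hb : ∃ C, ∀ x, |g x| ≤ C)
    (hb1 : ∃ C, ∀ x, |deriv g x| ≤ C) (hb2 : ∃ C, ∀ x, |iteratedDeriv 2 g x| ≤ C) (x : ℝ)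
    {t : ℝ} (ht : 0 < t) :
    HasDerivAt (fun s ↦ heat g s x) (1 / 2 * heat (iteratedDeriv 2 g) t x) t := by
  obtain ⟨M, hM⟩ := hb1
  have hM0 : 0 ≤ M := (abs_nonneg _).trans (hM 0)
  have hc := hg.continuous
  have hc1 : Continuous (deriv g) := hg.continuous_deriv (by norm_num)
  have hc2 := continuous_iteratedDeriv_two hg
  have iz : Integrable (fun z : ℝ ↦ |z|) (gaussianReal 0 1) := by
    simpa using (integrable_pow_gaussianReal 1).abs
  have hder : ∀ z : ℝ, ∀ s ∈ Ioi (t / 2), HasDerivAt (fun s ↦ g (x + √s * z))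
      (deriv g (x + √s * z) * (1 / (2 * √s) * z)) s := by
    intro z s hs
    have hs0 : 0 < s := lt_trans (half_pos ht) hs
    have h1 : HasDerivAt (fun s ↦ x + √s * z) (1 / (2 * √s) * z) s :=
      ((Real.hasDerivAt_sqrt hs0.ne').mul_const z).const_add x
    exact (hasDerivAt_of_contDiff_two hg _).comp s h1
  have h := hasDerivAt_integral_of_dominated_loc_of_deriv_le (μ := gaussianReal 0 1)
    (F := fun s z ↦ g (x + √s * z)) (F' := fun s z ↦ deriv g (x + √s * z) * (1 / (2 * √s) * z))
    (x₀ := t) (s := Ioi (t / 2)) (bound := fun z ↦ M * (1 / (2 * √(t / 2))) * |z|)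
    (Ioi_mem_nhds (half_lt_self ht))
    (Eventually.of_forall fun s ↦ Continuous.aestronglyMeasurable (by fun_prop))
    (integrable_heat hc (ExpGrowth.of_bounded hb) t x)
    (Continuous.aestronglyMeasurable (by fun_prop))
    (Eventually.of_forall fun z s hs ↦ by
      have hs0 : 0 < s := lt_trans (half_pos ht) hs
      have h2 : √(t / 2) ≤ √s := Real.sqrt_le_sqrt (le_of_lt hs)
      have h3 : 0 < √(t / 2) := Real.sqrt_pos.2 (half_pos ht)
      rw [Real.norm_eq_abs, abs_mul, abs_mul, abs_of_nonneg (by positivity : 0 ≤ 1 / (2 * √s)),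
        mul_assoc]
      gcongr
      exact hM _)
    (iz.const_mul _)
    (Eventually.of_forall fun z s hs ↦ hder z s hs)
  refine h.2.congr_deriv ?_
  have hst : 0 < √t := Real.sqrt_pos.2 ht
  have stein := integral_mul_gaussianReal_eq_integral_deriv
    (u := fun z ↦ deriv g (x + √t * z)) (u' := fun z ↦ √t * iteratedDeriv 2 g (x + √t * z))
    (fun z ↦ by
      have h1 : HasDerivAt (fun z ↦ x + √t * z) (√t) z := by
        simpa using ((hasDerivAt_id' z).const_mul (√t)).const_add x
      exact ((hasDerivAt_deriv_of_contDiff_two hg _).comp z h1).congr_deriv (mul_comm _ _))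
    (integrable_heat hc1 (ExpGrowth.of_bounded ⟨M, hM⟩) t x)
    ((iz.const_mul M).mono' (Continuous.aestronglyMeasurable (by fun_prop))
      (Eventually.of_forall fun z ↦ by
        rw [Real.norm_eq_abs, abs_mul]; gcongr; exact hM _))
    ((integrable_heat hc2 (ExpGrowth.of_bounded hb2) t x).const_mul _)
  have e : ∀ z, deriv g (x + √t * z) * (1 / (2 * √t) * z) =
      1 / (2 * √t) * (deriv g (x + √t * z) * z) := fun z ↦ by ring
  simp only [e]
  rw [integral_const_mul, stein, integral_const_mul, heat]
  field_simp

lemma bounded_resettingOperator (hb : ∃ C, ∀ x, |g x| ≤ C)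
    (hb2 : ∃ C, ∀ x, |iteratedDeriv 2 g x| ≤ C) (r : ℝ≥0) (xR : ℝ) :
    ∃ C, ∀ x, |resettingOperator r xR g x| ≤ C := by
  obtain ⟨C, hC⟩ := hb
  obtain ⟨D, hD⟩ := hb2
  refine ⟨1 / 2 * D + r * (C + C), fun x ↦ ?_⟩
  rw [resettingOperator]
  refine (abs_add_le _ _).trans ?_
  rw [abs_mul, abs_mul, abs_of_pos (by norm_num : (0 : ℝ) < 1 / 2), NNReal.abs_eq]
  gcongr
  · exact hD x
  · exact (abs_sub _ _).trans (add_le_add (hC _) (hC _))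

lemma continuous_resettingOperator (hg : ContDiff ℝ 2 g) (r : ℝ≥0) (xR : ℝ) :
    Continuous (resettingOperator r xR g) := by
  have h1 := continuous_iteratedDeriv_two hg
  have h2 := hg.continuous
  unfold resettingOperator
  fun_prop

lemma heat_resettingOperator (hg : ContDiff ℝ 2 g) (hb : ∃ C, ∀ x, |g x| ≤ C)
    (hb2 : ∃ C, ∀ x, |iteratedDeriv 2 g x| ≤ C) (r : ℝ≥0) (xR s x : ℝ) :
    heat (resettingOperator r xR g) s x =
      1 / 2 * heat (iteratedDeriv 2 g) s x + r * (g xR - heat g s x) := by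
  have i1 := (integrable_heat (continuous_iteratedDeriv_two hg) (ExpGrowth.of_bounded hb2) s x)
  have i2 := (integrable_heat hg.continuous (ExpGrowth.of_bounded hb) s x)
  have i3 : Integrable (fun z ↦ g xR - g (x + √s * z)) (gaussianReal 0 1) :=
    (integrable_const _).sub i2
  simp only [heat, resettingOperator]
  rw [integral_add (i1.const_mul _) (i3.const_mul _), integral_const_mul, integral_const_mul,
    integral_sub (integrable_const _) i2]
  simp

/-- The Kolmogorov forward equation `d/dt 𝔼[g(X_t)] = 𝔼[𝒜g(X_t)]`, in terms of the renewal
formula. -/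
theorem hasDerivAt_expectation (hg : ContDiff ℝ 2 g) (hb : ∃ C, ∀ x, |g x| ≤ C)
    (hb1 : ∃ C, ∀ x, |deriv g x| ≤ C) (hb2 : ∃ C, ∀ x, |iteratedDeriv 2 g x| ≤ C)
    (r : ℝ≥0) (xR x₀ : ℝ) {t : ℝ} (ht : 0 < t) :
    HasDerivAt (fun s ↦ expectation r xR g x₀ s)
      (expectation r xR (resettingOperator r xR g) x₀ t) t := by
  have hexp : ∀ s : ℝ,
      HasDerivAt (fun t : ℝ ↦ Real.exp (-(r * t))) (-r * Real.exp (-(r * s))) s := by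
    intro s
    have := ((hasDerivAt_id' s).const_mul (r : ℝ)).fun_neg.exp
    exact this.congr_deriv (by ring)
  have hcg := continuous_heat hg.continuous (ExpGrowth.of_bounded hb) xR
  have hcA := continuous_heat (continuous_resettingOperator hg r xR)
    (ExpGrowth.of_bounded (bounded_resettingOperator hb hb2 r xR)) xR
  have hcont : Continuous fun s ↦ r * Real.exp (-(r * s)) * heat g s xR := by fun_prop
  have hcontA : Continuous fun s ↦
      r * Real.exp (-(r * s)) * heat (resettingOperator r xR g) s xR := by fun_prop
  have d := ((hexp t).mul (hasDerivAt_heat hg hb hb1 hb2 x₀ ht)).add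
    (hcont.integral_hasStrictDerivAt 0 t).hasDerivAt
  refine d.congr_deriv ?_
  -- the integrand is the derivative of `r e^{-rs} (heat g s xR - g xR)`
  have ftc := intervalIntegral.integral_eq_sub_of_hasDerivAt_of_le ht.le
    (f := fun s ↦ r * (Real.exp (-(r * s)) * (heat g s xR - g xR)))
    (f' := fun s ↦ r * Real.exp (-(r * s)) * heat (resettingOperator r xR g) s xR)
    (Continuous.continuousOn (by fun_prop))
    (fun s hs ↦ by
      have := (((hexp s).mul ((hasDerivAt_heat hg hb hb1 hb2 xR hs.1).sub_const (g xR)))).const_mul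
        (r : ℝ)
      refine this.congr_deriv ?_
      rw [heat_resettingOperator hg hb hb2]
      ring)
    (hcontA.intervalIntegrable _ _)
  rw [expectation, ftc, heat_resettingOperator hg hb hb2, heat_zero]
  ring

lemma continuous_expectation (hg : Continuous g) (h : ExpGrowth g) (r xR x₀ : ℝ) :
    Continuous (fun t ↦ expectation r xR g x₀ t) := by
  have h1 := continuous_heat hg h x₀
  have h2 := continuous_heat hg h xR
  have h3 : Continuous fun s ↦ r * Real.exp (-(r * s)) * heat g s xR := by fun_prop
  have h4 : Continuous fun t ↦ ∫ s in 0..t, r * Real.exp (-(r * s)) * heat g s xR :=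
    intervalIntegral.continuous_primitive (fun a b ↦ h3.intervalIntegrable a b) 0
  unfold expectation
  fun_prop

lemma expectation_zero (g : ℝ → ℝ) (r xR x₀ : ℝ) : expectation r xR g x₀ 0 = g x₀ := by
  simp [expectation, heat_zero]

end Evolution

/-! ### Test functions and the adjoint -/

section Adjoint

/-- The smooth compactly supported test functions on the line. -/
abbrev RealTestFunction := 𝓓((⊤ : TopologicalSpace.Opens ℝ), ℝ)

lemma lineDeriv_testFunction (φ : RealTestFunction) :
    ⇑(∂_{(1 : ℝ)} φ : RealTestFunction) = deriv φ := by
  ext x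
  have hd : Differentiable ℝ φ := φ.contDiff.differentiable (by simp)
  rw [TestFunction.lineDerivOp_eq_lineDerivCLM ℝ, TestFunction.lineDerivCLM_apply_of_le (by simp),
    (hd x).lineDeriv_eq_fderiv, fderiv_apply_one_eq_deriv]

lemma lineDeriv_lineDeriv_testFunction (φ : RealTestFunction) :
    ⇑(∂_{(1 : ℝ)} (∂_{(1 : ℝ)} φ : RealTestFunction) : RealTestFunction) = iteratedDeriv 2 φ := by
  rw [lineDeriv_testFunction, lineDeriv_testFunction, iteratedDeriv_succ, iteratedDeriv_one]

lemma testFunction_contDiff_two (φ : RealTestFunction) : ContDiff ℝ 2 φ :=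
  φ.contDiff.of_le (by norm_cast)

lemma testFunction_bounded (φ : RealTestFunction) : ∃ C, ∀ x, |φ x| ≤ C :=
  φ.hasCompactSupport.exists_bound_of_continuous φ.continuous

lemma testFunction_bounded_deriv (φ : RealTestFunction) : ∃ C, ∀ x, |deriv φ x| ≤ C := by
  simpa only [lineDeriv_testFunction] using testFunction_bounded (∂_{(1 : ℝ)} φ)

lemma testFunction_bounded_iteratedDeriv_two (φ : RealTestFunction) :
    ∃ C, ∀ x, |iteratedDeriv 2 φ x| ≤ C := by
  simpa only [lineDeriv_lineDeriv_testFunction] using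
    testFunction_bounded (∂_{(1 : ℝ)} (∂_{(1 : ℝ)} φ))

lemma integrable_mul_bounded {f h : ℝ → ℝ} (hf : Integrable f) (hh : Continuous h)
    (hb : ∃ C, ∀ x, |h x| ≤ C) : Integrable (fun z ↦ f z * h z) := by
  obtain ⟨C, hC⟩ := hb
  exact hf.mul_bdd (c := C) hh.aestronglyMeasurable (Eventually.of_forall hC)

lemma lineDeriv_lineDeriv_ofFun_apply {f : ℝ → ℝ} (hf : LocallyIntegrable f)
    (φ : RealTestFunction) :
    (∂_{(1 : ℝ)} (∂_{(1 : ℝ)} (ofFun f))) φ = ∫ x, f x * iteratedDeriv 2 φ x := by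
  rw [Distribution.lineDerivOp_apply_apply, map_neg, Distribution.lineDerivOp_apply_apply, map_neg,
    neg_neg, ofFun_apply hf, lineDeriv_lineDeriv_testFunction]
  simp only [mul_comm]

/-- `∫ f 𝒜g` split into its three terms. -/
lemma integral_mul_resettingOperator {f g : ℝ → ℝ} (hf : Integrable f) (hg : ContDiff ℝ 2 g)
    (hb : ∃ C, ∀ x, |g x| ≤ C) (hb2 : ∃ C, ∀ x, |iteratedDeriv 2 g x| ≤ C) (r : ℝ≥0) (xR : ℝ) :
    ∫ z, f z * resettingOperator r xR g z =
      1 / 2 * (∫ z, f z * iteratedDeriv 2 g z) + r * ((∫ z, f z) * g xR - ∫ z, f z * g z) := by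
  have i1 := integrable_mul_bounded hf hg.continuous hb
  have i2 := integrable_mul_bounded hf (continuous_iteratedDeriv_two hg) hb2
  have e : ∀ z, f z * resettingOperator r xR g z =
      1 / 2 * (f z * iteratedDeriv 2 g z) + r * (f z * g xR - f z * g z) := fun z ↦ by
    rw [resettingOperator]; ring
  have i3 : Integrable (fun z ↦ f z * g xR - f z * g z) := (hf.mul_const _).sub i1
  simp only [e]
  rw [integral_add (i2.const_mul _) (i3.const_mul _), integral_const_mul, integral_const_mul,
    integral_sub (hf.mul_const _) i1, integral_mul_const]

lemma resettingAdjoint_apply {f : ℝ → ℝ} (hf : Integrable f) (r : ℝ≥0) (xR : ℝ)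
    (φ : RealTestFunction) :
    resettingAdjoint r xR f φ = ∫ z, f z * resettingOperator r xR φ z := by
  rw [integral_mul_resettingOperator hf (testFunction_contDiff_two φ) (testFunction_bounded φ)
    (testFunction_bounded_iteratedDeriv_two φ),
    ← lineDeriv_lineDeriv_ofFun_apply hf.locallyIntegrable]
  have h : ofFun f φ = ∫ z, f z * φ z := by
    simp only [ofFun_apply hf.locallyIntegrable, mul_comm]
  rw [← h]
  rfl

/-- Integration by parts twice, without boundary terms. -/
lemma integral_mul_iteratedDeriv_two {f g : ℝ → ℝ} (hf : ContDiff ℝ 2 f) (hf0 : Integrable f)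
    (hf1 : Integrable (deriv f)) (hf2 : Integrable (iteratedDeriv 2 f)) (hg : ContDiff ℝ 2 g)
    (hb : ∃ C, ∀ x, |g x| ≤ C) (hb1 : ∃ C, ∀ x, |deriv g x| ≤ C)
    (hb2 : ∃ C, ∀ x, |iteratedDeriv 2 g x| ≤ C) :
    ∫ z, f z * iteratedDeriv 2 g z = ∫ z, iteratedDeriv 2 f z * g z := by
  have hc1 : Continuous (deriv g) := hg.continuous_deriv (by norm_num)
  have hc2 := continuous_iteratedDeriv_two hg
  rw [integral_mul_deriv_eq_deriv_mul_of_integrable (u := f) (v := deriv g)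
      (fun z _ ↦ hasDerivAt_of_contDiff_two hf z) (fun z _ ↦ hasDerivAt_deriv_of_contDiff_two hg z)
      (integrable_mul_bounded hf0 hc2 hb2) (integrable_mul_bounded hf1 hc1 hb1)
      (integrable_mul_bounded hf0 hc1 hb1),
    integral_mul_deriv_eq_deriv_mul_of_integrable (u := deriv f) (v := g)
      (fun z _ ↦ hasDerivAt_deriv_of_contDiff_two hf z) (fun z _ ↦ hasDerivAt_of_contDiff_two hg z)
      (integrable_mul_bounded hf1 hc1 hb1) (integrable_mul_bounded hf2 hg.continuous hb)
      (integrable_mul_bounded hf1 hg.continuous hb), neg_neg]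

/-- On smooth functions the distributional second derivative is the classical one. -/
lemma lineDeriv_lineDeriv_ofFun {f : ℝ → ℝ} (hf : ContDiff ℝ 2 f) (hf0 : Integrable f)
    (hf1 : Integrable (deriv f)) (hf2 : Integrable (iteratedDeriv 2 f)) :
    ∂_{(1 : ℝ)} (∂_{(1 : ℝ)} (ofFun f)) = ofFun (iteratedDeriv 2 f) := by
  ext φ
  rw [lineDeriv_lineDeriv_ofFun_apply hf0.locallyIntegrable, ofFun_apply hf2.locallyIntegrable,
    integral_mul_iteratedDeriv_two hf hf0 hf1 hf2 (testFunction_contDiff_two φ)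
      (testFunction_bounded φ) (testFunction_bounded_deriv φ)
      (testFunction_bounded_iteratedDeriv_two φ)]
  simp only [mul_comm]

end Adjoint

/-! ### The generator of the solution -/

section Solution

lemma HasGenerator.unique {Ω : Type*} [MeasurableSpace Ω] {P : Measure Ω}
    {X : ℝ → ℝ≥0 → Ω → ℝ} {g h h' : ℝ → ℝ} (H : HasGenerator X P g h) (H' : HasGenerator X P g h') :
    h = h' :=
  funext fun x ↦ tendsto_nhds_unique (H.2 x) (H'.2 x)

variable {Ω : Type*} [MeasurableSpace Ω] {P : Measure Ω} [IsProbabilityMeasure P]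
  {W : ℝ≥0 → Ω → ℝ} {N : ℝ≥0 → Ω → ℕ} {r : ℝ≥0} {xR x₀ : ℝ} {X : ℝ → ℝ≥0 → Ω → ℝ} {g : ℝ → ℝ}

lemma tendsto_coe_nhdsGT_zero : Tendsto (fun t : ℝ≥0 ↦ (t : ℝ)) (𝓝[>] 0) (𝓝[>] 0) := by
  refine tendsto_nhdsWithin_iff.2 ⟨(NNReal.continuous_coe.tendsto' 0 0 rfl).mono_left
    nhdsWithin_le_nhds, ?_⟩
  filter_upwards [self_mem_nhdsWithin] with t ht
  exact_mod_cast ht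

/-- The generator, pointwise for `S = {x}` and uniformly for `S = univ`. -/
theorem UniformTaylor.tendstoUniformlyOn (hWm : ∀ t, Measurable (W t)) (hW : IsBrownianReal W P)
    (hN : IsPoissonProcess N r P) (hWN : IndepFun (fun ω t ↦ W t ω) (fun ω t ↦ N t ω) P)
    (hX : ∀ x₀, IsResettingSolution P W N xR x₀ (X x₀)) {S : Set ℝ} (hS : UniformTaylor g S)
    (hg : Continuous g) (h : ExpGrowth g) {B : ℝ} (hB : ∀ x ∈ S, |g x| ≤ B)
    (hB2 : ∀ x ∈ S, |iteratedDeriv 2 g x| ≤ B) :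
    TendstoUniformlyOn (generatorQuotient X P g) (resettingOperator r xR g) (𝓝[>] 0) S := by
  refine Metric.tendstoUniformlyOn_iff.2 fun ε hε ↦ ?_
  filter_upwards [tendsto_coe_nhdsGT_zero.eventually
    (hS.expectation_quotient hg h hB hB2 r xR hε)] with t ht x hx
  rw [dist_comm, Real.dist_eq, generatorQuotient, (hX x).integral_comp hWm hW hN hWN hg h]
  exact ht x hx

theorem hasGenerator_resettingOperator (hWm : ∀ t, Measurable (W t)) (hW : IsBrownianReal W P)
    (hN : IsPoissonProcess N r P) (hWN : IndepFun (fun ω t ↦ W t ω) (fun ω t ↦ N t ω) P)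
    (hX : ∀ x₀, IsResettingSolution P W N xR x₀ (X x₀)) (hg : ContDiff ℝ 2 g) (h : ExpGrowth g) :
    HasGenerator X P g (resettingOperator r xR g) := by
  refine ⟨fun x t ↦ (hX x).integrable_comp hWm hW hN hWN hg.continuous h t, fun x ↦ ?_⟩
  have := (uniformTaylor_singleton hg h x).tendstoUniformlyOn hWm hW hN hWN hX hg.continuous h
    (B := max |g x| |iteratedDeriv 2 g x|) (by simp) (by simp)
  exact this.tendsto_at (mem_singleton x)

theorem hasAdjointGenerator_iff (hWm : ∀ t, Measurable (W t)) (hW : IsBrownianReal W P)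
    (hN : IsPoissonProcess N r P) (hWN : IndepFun (fun ω t ↦ W t ω) (fun ω t ↦ N t ω) P)
    (hX : ∀ x₀, IsResettingSolution P W N xR x₀ (X x₀)) {f : ℝ → ℝ} (hf : Integrable f)
    (T : 𝓓'((⊤ : TopologicalSpace.Opens ℝ), ℝ)) :
    HasAdjointGenerator X P f T ↔ T = resettingAdjoint r xR f := by
  have hA (φ : RealTestFunction) :
      HasGenerator X P φ (resettingOperator r xR φ) :=
    hasGenerator_resettingOperator hWm hW hN hWN hX (testFunction_contDiff_two φ)
      (ExpGrowth.of_bounded (testFunction_bounded φ))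
  constructor
  · intro H
    ext φ
    obtain ⟨h, h1, -, h3⟩ := H φ
    rw [h3, resettingAdjoint_apply hf, h1.unique (hA φ)]
  · rintro rfl φ
    exact ⟨_, hA φ, integrable_mul_bounded hf
      (continuous_resettingOperator (testFunction_contDiff_two φ) r xR)
      (bounded_resettingOperator (testFunction_bounded φ)
        (testFunction_bounded_iteratedDeriv_two φ) r xR), resettingAdjoint_apply hf r xR φ⟩

/-! ### The density and the Fokker-Planck equation -/

variable {Y : ℝ≥0 → Ω → ℝ}

lemma integrable_density {t : ℝ} (hY : HasPDF (Y t.toNNReal) P volume) :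
    Integrable (density Y P t) := by
  have : Integrable (fun z ↦ (pdf (Y t.toNNReal) P volume z).toReal • (1 : ℝ)) :=
    (pdf.integrable_pdf_smul_iff (f := fun _ ↦ (1 : ℝ)) (by fun_prop)).2 (integrable_const _)
  simp only [smul_eq_mul, mul_one] at this
  exact this

lemma integral_density_mul {t : ℝ} (hY : HasPDF (Y t.toNNReal) P volume) (hg : Continuous g) :
    ∫ z, density Y P t z * g z = ∫ ω, g (Y t.toNNReal ω) ∂P :=
  pdf.integral_pdf_smul hg.aestronglyMeasurable

lemma integral_density {t : ℝ} (hY : HasPDF (Y t.toNNReal) P volume) :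
    ∫ z, density Y P t z = 1 := by
  simpa using integral_density_mul hY (g := fun _ ↦ 1) continuous_const

lemma IsResettingSolution.ofFun_density_apply (hWm : ∀ t, Measurable (W t))
    (hW : IsBrownianReal W P)
    (hN : IsPoissonProcess N r P) (hWN : IndepFun (fun ω t ↦ W t ω) (fun ω t ↦ N t ω) P)
    (hY : IsResettingSolution P W N xR x₀ Y) {t : ℝ} (ht : 0 < t)
    (φ : RealTestFunction) :
    ofFun (density Y P t) φ = expectation r xR φ x₀ t := by
  have hpdf := hY.hasPDF hWm hW hN hWN (Real.toNNReal_pos.2 ht)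
  rw [ofFun_apply (integrable_density hpdf).locallyIntegrable]
  simp only [mul_comm (φ _)]
  rw [integral_density_mul hpdf φ.continuous, hY.integral_comp hWm hW hN hWN φ.continuous
    (ExpGrowth.of_bounded (testFunction_bounded φ)), Real.coe_toNNReal _ ht.le]

/-- The Fokker-Planck equation `∂ₜ p = 𝒜* p` in the weak form. -/
theorem IsResettingSolution.hasTimeDerivAt (hWm : ∀ t, Measurable (W t))
    (hW : IsBrownianReal W P)
    (hN : IsPoissonProcess N r P) (hWN : IndepFun (fun ω t ↦ W t ω) (fun ω t ↦ N t ω) P)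
    (hY : IsResettingSolution P W N xR x₀ Y) {t : ℝ} (ht : 0 < t) :
    HasTimeDerivAt (fun s ↦ ofFun (density Y P s)) (resettingAdjoint r xR (density Y P t)) t := by
  intro φ
  have hpdf := hY.hasPDF hWm hW hN hWN (Real.toNNReal_pos.2 ht)
  have hφ := testFunction_contDiff_two φ
  have hb := testFunction_bounded φ
  have hb2 := testFunction_bounded_iteratedDeriv_two φ
  have hA := continuous_resettingOperator hφ r xR
  have e : resettingAdjoint r xR (density Y P t) φ =
      expectation r xR (resettingOperator r xR φ) x₀ t := by
    rw [resettingAdjoint_apply (integrable_density hpdf), integral_density_mul hpdf hA,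
      hY.integral_comp hWm hW hN hWN hA (ExpGrowth.of_bounded
        (bounded_resettingOperator hb hb2 r xR)), Real.coe_toNNReal _ ht.le]
  rw [e]
  refine (hasDerivAt_expectation hφ hb (testFunction_bounded_deriv φ) hb2 r xR x₀
    ht).congr_of_eventuallyEq ?_
  filter_upwards [Ioi_mem_nhds ht] with s hs
  exact hY.ofFun_density_apply hWm hW hN hWN hs φ

end Solution

end Resetting

theorem mainTheorem6
    {Ω : Type*} [MeasurableSpace Ω] (P : Measure Ω) [IsProbabilityMeasure P]
    (r : ℝ≥0) (xR : ℝ)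
    (W : ℝ≥0 → Ω → ℝ) (hWm : ∀ t, Measurable (W t)) (hW : IsBrownianReal W P)
    (N : ℝ≥0 → Ω → ℕ) (hN : Resetting.IsPoissonProcess N r P)
    (hWN : IndepFun (fun ω t ↦ W t ω) (fun ω t ↦ N t ω) P)
    (X : ℝ → ℝ≥0 → Ω → ℝ)
    (hX : ∀ x₀, Resetting.IsResettingSolution P W N xR x₀ (X x₀)) :
    -- the generator, pointwise, for smooth functions of at most exponential growth
    (∀ g : ℝ → ℝ, ContDiff ℝ 2 g → (∃ C c : ℝ, ∀ x, |g x| ≤ C * Real.exp (c * |x|)) →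
      Resetting.HasGenerator X P g (Resetting.resettingOperator r xR g)) ∧
    -- the generator, uniformly in the starting point
    (∀ g : ℝ → ℝ, ContDiff ℝ 2 g → (∃ C, ∀ x, |g x| ≤ C) →
      (∃ C, ∀ x, |iteratedDeriv 2 g x| ≤ C) → UniformContinuous (iteratedDeriv 2 g) →
      TendstoUniformly (Resetting.generatorQuotient X P g)
        (Resetting.resettingOperator r xR g) (𝓝[>] 0)) ∧
    -- the adjoint, as a distribution
    (∀ f : ℝ → ℝ, Integrable f → ∀ T,
      Resetting.HasAdjointGenerator X P f T ↔ T = Resetting.resettingAdjoint r xR f) ∧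
    -- the adjoint on smooth functions, with the classical second derivative
    (∀ f : ℝ → ℝ, ContDiff ℝ 2 f → Integrable f → Integrable (deriv f) →
      Integrable (iteratedDeriv 2 f) →
      Resetting.resettingAdjoint r xR f =
        (1 / 2 : ℝ) • Resetting.ofFun (iteratedDeriv 2 f) +
          (r : ℝ) • ((∫ z, f z) • Distribution.delta xR - Resetting.ofFun f) ∧
      ∀ g : ℝ → ℝ, ContDiff ℝ 2 g → (∃ C, ∀ x, |g x| ≤ C) → (∃ C, ∀ x, |deriv g x| ≤ C) →
        (∃ C, ∀ x, |iteratedDeriv 2 g x| ≤ C) →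
        ∃ h, Resetting.HasGenerator X P g h ∧ Integrable (fun z ↦ f z * h z) ∧
          ∫ z, f z * h z =
            (∫ z, ((1 / 2) * iteratedDeriv 2 f z - r * f z) * g z) + r * (∫ z, f z) * g xR) ∧
    -- the density and its Fokker-Planck equation
    (∀ x₀ : ℝ,
      (∀ t : ℝ, 0 < t →
        HasPDF (X x₀ t.toNNReal) P volume ∧
        Integrable (Resetting.density (X x₀) P t) ∧
        ∫ z, Resetting.density (X x₀) P t z = 1 ∧
        ∃ T, Resetting.HasAdjointGenerator X P (Resetting.density (X x₀) P t) T ∧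
          Resetting.HasTimeDerivAt (fun s ↦ Resetting.ofFun (Resetting.density (X x₀) P s)) T t ∧
          T = Resetting.resettingAdjoint r xR (Resetting.density (X x₀) P t) ∧
          T = (1 / 2 : ℝ) • ∂_{(1 : ℝ)} (∂_{(1 : ℝ)}
                (Resetting.ofFun (Resetting.density (X x₀) P t))) +
              (r : ℝ) • Distribution.delta xR -
              (r : ℝ) • Resetting.ofFun (Resetting.density (X x₀) P t)) ∧
      ∀ φ : 𝓓((⊤ : TopologicalSpace.Opens ℝ), ℝ),
        Tendsto (fun t ↦ Resetting.ofFun (Resetting.density (X x₀) P t) φ)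
          (𝓝[>] 0) (𝓝 (φ x₀))) := by
  refine ⟨fun g hg h ↦ Resetting.hasGenerator_resettingOperator hWm hW hN hWN hX hg h,
    fun g hg hb hb2 hu ↦ ?_, fun f hf T ↦ Resetting.hasAdjointGenerator_iff hWm hW hN hWN hX hf T,
    fun f hf hf0 hf1 hf2 ↦ ⟨?_, fun g hg hb hb1 hb2 ↦ ?_⟩, fun x₀ ↦ ⟨fun t ht ↦ ?_, fun φ ↦ ?_⟩⟩
  · obtain ⟨C, hC⟩ := hb
    obtain ⟨D, hD⟩ := hb2
    rw [← tendstoUniformlyOn_univ]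
    exact (Resetting.uniformTaylor_univ hg ⟨D, hD⟩ hu).tendstoUniformlyOn hWm hW hN hWN hX
      hg.continuous (Resetting.ExpGrowth.of_bounded ⟨C, hC⟩) (B := max C D)
      (fun x _ ↦ (hC x).trans (le_max_left _ _)) (fun x _ ↦ (hD x).trans (le_max_right _ _))
  · rw [Resetting.resettingAdjoint, Resetting.lineDeriv_lineDeriv_ofFun hf hf0 hf1 hf2]
  · refine ⟨_, Resetting.hasGenerator_resettingOperator hWm hW hN hWN hX hg
      (Resetting.ExpGrowth.of_bounded hb), Resetting.integrable_mul_bounded hf0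
      (Resetting.continuous_resettingOperator hg r xR)
      (Resetting.bounded_resettingOperator hb hb2 r xR), ?_⟩
    have i1 := Resetting.integrable_mul_bounded hf2 hg.continuous hb
    have i2 := Resetting.integrable_mul_bounded hf0 hg.continuous hb
    rw [Resetting.integral_mul_resettingOperator hf0 hg hb hb2,
      Resetting.integral_mul_iteratedDeriv_two hf hf0 hf1 hf2 hg hb hb1 hb2]
    simp only [sub_mul, mul_assoc]
    rw [integral_sub (i1.const_mul _) (i2.const_mul _), integral_const_mul, integral_const_mul]
    ring
  · have hpdf := (hX x₀).hasPDF hWm hW hN hWN (Real.toNNReal_pos.2 ht)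
    have hint := Resetting.integrable_density hpdf
    refine ⟨hpdf, hint, Resetting.integral_density hpdf, _,
      (Resetting.hasAdjointGenerator_iff hWm hW hN hWN hX hint _).2 rfl,
      (hX x₀).hasTimeDerivAt hWm hW hN hWN ht, rfl, ?_⟩
    rw [Resetting.resettingAdjoint, Resetting.integral_density hpdf, one_smul, smul_sub,
      add_sub_assoc]
  · have hc := Resetting.continuous_expectation φ.continuous
      (Resetting.ExpGrowth.of_bounded (Resetting.testFunction_bounded φ)) r xR x₀
    have hlim := (hc.tendsto' 0 _ (Resetting.expectation_zero φ r xR x₀)).mono_left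
      (nhdsWithin_le_nhds (s := Ioi 0))
    refine hlim.congr' ?_
    filter_upwards [self_mem_nhdsWithin] with t ht
    exact ((hX x₀).ofFun_density_apply hWm hW hN hWN ht φ).symm
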